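/- **The calculus.** Fix a set of first-order values and first-order expressions over it (terms built from variables, values and operations on values; a closed expression $e$ evaluates to a value). Names are partitioned into countably many higher-order names $a,b,c$, first-order names $h,k$ and success names $\omega$. Processes, taken up to $\alpha$-conversion, are $$P ::= a(x,b).P \mid h(x).P \mid \overline a\langle e\rangle(b).P \mid \overline h\langle e\rangle.P \mid \omega.P \mid\, !a(x,b).P \mid\, !h(x).P \mid P|P \mid \nu a\,P \mid \nu h\,P \mid 0 \mid P+P \mid \mathtt{if}\ e=f\ \mathtt{then}\ P\ \mathtt{else}\ P,$$ where $x$ (a first-order variable) and $b$ are bound in $a(x,b).P$, $x$ is bound in $h(x).P$, and $b$ is bound (a fresh name is sent) in $\overline a\langle e\rangle(b).P$. Actions are $\mu ::= \tau\mid a\langle v\rangle(b)\mid \overline a\langle v\rangle(b)\mid h\langle v\rangle\mid\overline h\langle v\rangle\mid\omega$, with $b$ bound. The transitions $P\xrightarrow{\mu}P'$ of closed processes are the standard ones, early for values: communication at $a$ of $v$ and fresh $b$ turns $P|Q$ into $\nu b(P'|Q')$; $\omega.P\xrightarrow{\omega}0$; $!\alpha.P\xrightarrow{\mu}Q\,|\,!\alpha.P$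 if $\alpha.P\xrightarrow{\mu}Q$; parallel composition, restriction, sum and conditional as usual. Bound names of actions are fresh for everything else in sight. **Types.** A *visibility function* is a finite partial function $\Delta$ from higher-order names and a token $\mathsf{cur}$ to finite sets of higher-order names that is transitive: if $a\in\Delta(o)$ and $\Delta(a)$ is defined, then $\Delta(a)\subseteq\Delta(o)$. $\Delta\setminus p$ erases $p$ from domain and codomain. The judgement $\Delta\vdash P$ is defined by the rules (bound names fresh for $\Delta$, all functions being visibility functions): - $\Delta\vdash\overline a\langle e\rangle(b).P$ if $a\in\Delta(\mathsf{cur})$ and $(\Delta\setminus\mathsf{cur}),\,b\mapsto\Delta(\mathsf{cur})\cup\{b\}\vdash P$; - $\Delta\vdash a(x,b).P$ if $\Delta(\mathsf{cur})$ is undefined, $\Delta(a)$ is defined and $\Delta,\,\mathsf{cur}\mapsto\Delta(a)\cup\{b\}\vdash P$; - $\Delta\vdash\overline h\langle e\rangle.P$ if $\Delta\vdash P$ and $\Delta(\mathsf{cur})$ is undefined; $\Delta\vdash h(x).P$ if $\Delta\vdash P$ and $\Delta(\mathsf{cur})$ is defined; - $\Delta\vdash\,!\alpha.P$ if $\Delta\vdash\alpha.P$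 and $\Delta(\mathsf{cur})$ is undefined; $\Delta\vdash 0$ if $\Delta(\mathsf{cur})$ is undefined; $\Delta\vdash\omega.P$ always; - $\Delta\setminus a\vdash\nu a\,P$ if $\Delta\vdash P$; $\Delta\vdash\nu h\,P$ if $\Delta\vdash P$; $\Delta\vdash P_1+P_2$ and $\Delta\vdash\mathtt{if}\ e=f\ \mathtt{then}\ P_1\ \mathtt{else}\ P_2$ if $\Delta\vdash P_1$ and $\Delta\vdash P_2$; - $\Delta\vdash P_1|P_2$ if $\Delta_1\vdash P_1$, $\Delta_2\vdash P_2$, $\Delta=\Delta_1\cup\Delta_2$ (the pointwise union, on the union of the domains), and $\Delta_1,\Delta_2$ are *compatible*, i.e. not both defined at $\mathsf{cur}$. If $\Delta\vdash P$, then $P$ is a *$\Delta$-process*. **Barbed equivalence.** $P\Downarrow_\omega$ means that $P\,(\xrightarrow{\tau})^*\,P'$ and $P'\xrightarrow{\omega}$ for some $P'$. Barbed bisimilarity is the largest symmetric relation on closed processes such that, whenever $P,Q$ are related, each $P\xrightarrow{\tau}P'$ is matched by some $Q\,(\xrightarrow{\tau})^*\,Q'$ with $P',Q'$ related, and $P\Downarrow_\omega$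 implies $Q\Downarrow_\omega$ for each $\omega$. For compatible $\Delta,\Gamma$, closed $\Delta$-processes $P,Q$ are *barbed equivalent at $\Gamma$* if $P|R$ and $Q|R$ are barbed bisimilar for all closed $R$ with $\Gamma\vdash R$. **Typed bisimilarity.** The type-allowed transitions $\Gamma\triangleright P\xrightarrow{\mu}\Gamma'\triangleright P'$ (where $\Gamma$ is the visibility of the observer) hold if $P\xrightarrow{\mu}P'$ and one of: - $\mu=\overline a\langle v\rangle(b)$, $\Gamma(a)$ is defined, $\Gamma(\mathsf{cur})$ is undefined, $\Gamma'=\Gamma,\,\mathsf{cur}\mapsto\Gamma(a)\cup\{b\}$; - $\mu=a\langle v\rangle(b)$, $a\in\Gamma(\mathsf{cur})$, $\Gamma'=(\Gamma\setminus\mathsf{cur}),\,b\mapsto\Gamma(\mathsf{cur})\cup\{b\}$; - $\mu=\overline h\langle v\rangle$, $\Gamma(\mathsf{cur})$ is defined, $\Gamma'=\Gamma$; - $\mu=h\langle v\rangle$ or $\mu=\tau$, $\Gamma(\mathsf{cur})$ is undefined, $\Gamma'=\Gamma$. The weak type-allowed transition $\stackrel{\hat\mu}{\Longrightarrow}$ is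 a finite (possibly empty) sequence of type-allowed $\tau$-transitions if $\mu=\tau$, and a $\mu$-transition preceded and followed by such sequences otherwise. A typed bisimulation is a set of triples $(\Gamma,P,Q)$ such that each type-allowed transition $\Gamma\triangleright P\xrightarrow{\mu}\Gamma'\triangleright P'$ is matched by some $\Gamma\triangleright Q\stackrel{\hat\mu}{\Longrightarrow}\Gamma'\triangleright Q'$ with $(\Gamma',P',Q')$ in the set, and conversely for the transitions of $Q$. For compatible $\Delta,\Gamma$, closed $\Delta$-processes $P,Q$ are *bisimilar under $\Gamma$* if $(\Gamma,P,Q)$ belongs to some typed bisimulation. A closed process $P$ is *image-finite* (under $\Gamma$) if for every $\Gamma'\triangleright P'$ reachable from $\Gamma\triangleright P$ by type-allowed transitions and every action $\mu$, the set of all $P''$ with $\Gamma'\triangleright P'\stackrel{\hat\mu}{\Longrightarrow}\Gamma''\triangleright P''$ for some $\Gamma''$ is finite, up to $\alpha$-conversion. For processes with free first-order variables, the two equivalences and image-finiteness are required for all instances under closing substitutions of values for variables. **Theorem.** Let $\Delta,\Gamma$ be visibility functions and $P,Q$ processes. 1. (Soundness) If no success name occurs in $P$ and $Q$, and $P,Q$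 are $\Delta$-processes, with $\Delta$ compatible with $\Gamma$, that are bisimilar under $\Gamma$, then $P$ and $Q$ are barbed equivalent at $\Gamma$. 2. (Completeness) If $P,Q$ are image-finite under $\Gamma$, and are $\Delta$-processes, with $\Delta$ compatible with $\Gamma$, that are barbed equivalent at $\Gamma$, then $P$ and $Q$ are bisimilar under $\Gamma$. -/

import Mathlib

/-! The internal pi-calculus with first-order values, its operational semantics, the type
system for visibility, barbed equivalence, and typed labelled bisimilarity.

Higher-order names and first-order names are two separate kinds of names, both represented by
de Bruijn indices, so that alpha-equivalent processes are equal: under a binder of a higher-order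
(first-order) name, index `0` is the bound name and `k + 1` is the name `k` of the outside.
Free first-order variables are well scoped: `Proc L n` is the type of processes whose free
variables are among `n` given ones, so that `Proc L 0` is the type of closed processes. -/

namespace VPi

universe u

/-- First-order values and expressions are left arbitrary: any set of values, with any family of
operations on it. -/
structure ExprLang where
  Val : Type u
  Op : Type u
  arity : Op → ℕ
  interp : (f : Op) → (Fin (arity f) → Val) → Val

/-- First-order expressions over `n` variables. -/
inductive Expr (L : ExprLang.{u}) (n : ℕ) : Type u
  | var (x : Fin n) : Expr L n
  | val (v : L.Val) : Expr L n
  | app (f : L.Op) (args : Fin (L.arity f) → Expr L n) : Expr L n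

namespace Expr

variable {L : ExprLang.{u}}

def subst {n m : ℕ} (σ : Fin n → Expr L m) : Expr L n → Expr L m
  | var x => σ x
  | val v => val v
  | app f args => app f (fun i => subst σ (args i))

/-- Evaluation of closed expressions. -/
def eval : Expr L 0 → L.Val
  | var x => x.elim0
  | val v => v
  | app f args => L.interp f (fun i => eval (args i))

/-- The substitution `σ` below a binder of a first-order variable. -/
def lift {n m : ℕ} (σ : Fin n → Expr L m) : Fin (n + 1) → Expr L (m + 1) :=
  Fin.cases (var 0) (fun i => (σ i).subst (fun j => var j.succ))

end Expr

/-- Processes. Success names are natural numbers. -/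
inductive Proc (L : ExprLang.{u}) : ℕ → Type u
  /-- the process `0` -/
  | nil {n : ℕ} : Proc L n
  /-- `a(x, b). P`: binds the variable `x` and the higher-order name `b` in `P` -/
  | inH {n : ℕ} (a : ℕ) (P : Proc L (n + 1)) : Proc L n
  /-- `h(x). P`: binds the variable `x` in `P` -/
  | inF {n : ℕ} (h : ℕ) (P : Proc L (n + 1)) : Proc L n
  /-- the output `a⟨e⟩(b). P` of `e` and of a fresh `b`: binds the higher-order name `b` in `P` -/
  | outH {n : ℕ} (a : ℕ) (e : Expr L n) (P : Proc L n) : Proc L n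
  /-- the output `h⟨e⟩. P` -/
  | outF {n : ℕ} (h : ℕ) (e : Expr L n) (P : Proc L n) : Proc L n
  /-- `ω. P` -/
  | succ {n : ℕ} (ω : ℕ) (P : Proc L n) : Proc L n
  /-- `! a(x, b). P` -/
  | repH {n : ℕ} (a : ℕ) (P : Proc L (n + 1)) : Proc L n
  /-- `! h(x). P` -/
  | repF {n : ℕ} (h : ℕ) (P : Proc L (n + 1)) : Proc L n
  /-- `P | Q` -/
  | par {n : ℕ} (P Q : Proc L n) : Proc L n
  /-- `P + Q` -/
  | sum {n : ℕ} (P Q : Proc L n) : Proc L n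
  /-- `(ν a) P`, for a higher-order name `a` -/
  | resH {n : ℕ} (P : Proc L n) : Proc L n
  /-- `(ν h) P`, for a first-order name `h` -/
  | resF {n : ℕ} (P : Proc L n) : Proc L n
  /-- `if e = f then P else Q` -/
  | cond {n : ℕ} (e f : Expr L n) (P Q : Proc L n) : Proc L n

/-- The renaming `f` below a binder of a name. -/
def upRen (f : ℕ → ℕ) : ℕ → ℕ
  | 0 => 0
  | k + 1 => f k + 1

namespace Proc

variable {L : ExprLang.{u}}

/-- Renaming of the free higher-order names. -/
def renH : {n : ℕ} → (ℕ → ℕ) → Proc L n → Proc L n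
  | _, _, nil => nil
  | _, f, inH a P => inH (f a) (renH (upRen f) P)
  | _, f, inF h P => inF h (renH f P)
  | _, f, outH a e P => outH (f a) e (renH (upRen f) P)
  | _, f, outF h e P => outF h e (renH f P)
  | _, f, succ ω P => succ ω (renH f P)
  | _, f, repH a P => repH (f a) (renH (upRen f) P)
  | _, f, repF h P => repF h (renH f P)
  | _, f, par P Q => par (renH f P) (renH f Q)
  | _, f, sum P Q => sum (renH f P) (renH f Q)
  | _, f, resH P => resH (renH (upRen f) P)
  | _, f, resF P => resF (renH f P)
  | _, f, cond e e' P Q => cond e e' (renH f P) (renH f Q)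

/-- Substitution of expressions for the free first-order variables. -/
def subst : {n m : ℕ} → (Fin n → Expr L m) → Proc L n → Proc L m
  | _, _, _, nil => nil
  | _, _, σ, inH a P => inH a (subst (Expr.lift σ) P)
  | _, _, σ, inF h P => inF h (subst (Expr.lift σ) P)
  | _, _, σ, outH a e P => outH a (e.subst σ) (subst σ P)
  | _, _, σ, outF h e P => outF h (e.subst σ) (subst σ P)
  | _, _, σ, succ ω P => succ ω (subst σ P)
  | _, _, σ, repH a P => repH a (subst (Expr.lift σ) P)
  | _, _, σ, repF h P => repF h (subst (Expr.lift σ) P)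
  | _, _, σ, par P Q => par (subst σ P) (subst σ Q)
  | _, _, σ, sum P Q => sum (subst σ P) (subst σ Q)
  | _, _, σ, resH P => resH (subst σ P)
  | _, _, σ, resF P => resF (subst σ P)
  | _, _, σ, cond e f P Q => cond (e.subst σ) (f.subst σ) (subst σ P) (subst σ Q)

/-- The closed process obtained from `P` by a closing substitution of values for variables. -/
def close {n : ℕ} (σ : Fin n → L.Val) (P : Proc L n) : Proc L 0 :=
  P.subst (fun i => Expr.val (σ i))

/-- `P[v/x]`, where `x` is the only free variable of `P`. -/
def inst (v : L.Val) (P : Proc L 1) : Proc L 0 := P.close (fun _ => v)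

/-- No success name occurs in the process. -/
def SuccessFree : {n : ℕ} → Proc L n → Prop
  | _, nil => True
  | _, inH _ P => SuccessFree P
  | _, inF _ P => SuccessFree P
  | _, outH _ _ P => SuccessFree P
  | _, outF _ _ P => SuccessFree P
  | _, succ _ _ => False
  | _, repH _ P => SuccessFree P
  | _, repF _ P => SuccessFree P
  | _, par P Q => SuccessFree P ∧ SuccessFree Q
  | _, sum P Q => SuccessFree P ∧ SuccessFree Q
  | _, resH P => SuccessFree P
  | _, resF P => SuccessFree P
  | _, cond _ _ P Q => SuccessFree P ∧ SuccessFree Q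

end Proc

/-- Actions. In `inH a v` (input of `v` and of a fresh name `b` at `a`) and in `outH a v` (output
of `v` and of a fresh name `b` at `a`), the name `b` is bound and left implicit: after such an
action, it is the higher-order name `0` of the derivative, and the other higher-order names
are shifted by one. -/
inductive Act (L : ExprLang.{u}) : Type u
  | tau : Act L
  | inH (a : ℕ) (v : L.Val) : Act L
  | outH (a : ℕ) (v : L.Val) : Act L
  | inF (h : ℕ) (v : L.Val) : Act L
  | outF (h : ℕ) (v : L.Val) : Act L
  | succ (ω : ℕ) : Act L

namespace Act

variable {L : ExprLang.{u}}

/-- Renaming of the free higher-order names of an action. -/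
def renH (f : ℕ → ℕ) : Act L → Act L
  | inH a v => inH (f a) v
  | outH a v => outH (f a) v
  | μ => μ

/-- Renaming of the free first-order names of an action. -/
def renF (f : ℕ → ℕ) : Act L → Act L
  | inF h v => inF (f h) v
  | outF h v => outF (f h) v
  | μ => μ

/-- `μ.weaken Q` is the process `Q`, to be put in parallel with a derivative of an action `μ`: its
names are shifted if `μ` binds a name (which is then fresh for `Q`). -/
def weaken : Act L → Proc L 0 → Proc L 0
  | inH _ _, Q => Q.renH Nat.succ
  | outH _ _, Q => Q.renH Nat.succ
  | _, Q => Q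

/-- `μ.res P` is the process `(ν a) P`, where `P` is a derivative of an action `μ` which took place
below the restriction `(ν a)`: if `μ` binds a name, then in `P` this name is `0` and `a` is `1`. -/
def res : Act L → Proc L 0 → Proc L 0
  | inH _ _, P => Proc.resH (P.renH (Equiv.swap 0 1))
  | outH _ _, P => Proc.resH (P.renH (Equiv.swap 0 1))
  | _, P => Proc.resH P

end Act

section Semantics

variable {L : ExprLang.{u}}

open Proc

/-- The (untyped, early for values) labelled transition system, on closed processes. In the rules
for restriction, that the label is the image of `μ` under the shift says that the restricted
name is not free in it. -/
inductive Step : Proc L 0 → Act L → Proc L 0 → Prop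
  | inH (a : ℕ) (v : L.Val) (P : Proc L 1) : Step (inH a P) (Act.inH a v) (P.inst v)
  | outH (a : ℕ) (e : Expr L 0) (P : Proc L 0) : Step (outH a e P) (Act.outH a e.eval) P
  | inF (h : ℕ) (v : L.Val) (P : Proc L 1) : Step (inF h P) (Act.inF h v) (P.inst v)
  | outF (h : ℕ) (e : Expr L 0) (P : Proc L 0) : Step (outF h e P) (Act.outF h e.eval) P
  | succ (ω : ℕ) (P : Proc L 0) : Step (succ ω P) (Act.succ ω) nil
  | repH {a : ℕ} {P : Proc L 1} {μ : Act L} {Q : Proc L 0} :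
      Step (inH a P) μ Q → Step (repH a P) μ (par Q (μ.weaken (repH a P)))
  | repF {h : ℕ} {P : Proc L 1} {μ : Act L} {Q : Proc L 0} :
      Step (inF h P) μ Q → Step (repF h P) μ (par Q (μ.weaken (repF h P)))
  | resH {P Q : Proc L 0} {μ : Act L} :
      Step P (μ.renH Nat.succ) Q → Step (resH P) μ (μ.res Q)
  | resF {P Q : Proc L 0} {μ : Act L} :
      Step P (μ.renF Nat.succ) Q → Step (resF P) μ (resF Q)
  | sumL {P P' Q : Proc L 0} {μ : Act L} : Step P μ P' → Step (sum P Q) μ P'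
  | sumR {P Q Q' : Proc L 0} {μ : Act L} : Step Q μ Q' → Step (sum P Q) μ Q'
  | parL {P P' Q : Proc L 0} {μ : Act L} :
      Step P μ P' → Step (par P Q) μ (par P' (μ.weaken Q))
  | parR {P Q Q' : Proc L 0} {μ : Act L} :
      Step Q μ Q' → Step (par P Q) μ (par (μ.weaken P) Q')
  | comHL {P P' Q Q' : Proc L 0} {a : ℕ} {v : L.Val} :
      Step P (Act.inH a v) P' → Step Q (Act.outH a v) Q' →
      Step (par P Q) Act.tau (resH (par P' Q'))
  | comHR {P P' Q Q' : Proc L 0} {a : ℕ} {v : L.Val} :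
      Step P (Act.outH a v) P' → Step Q (Act.inH a v) Q' →
      Step (par P Q) Act.tau (resH (par P' Q'))
  | comFL {P P' Q Q' : Proc L 0} {h : ℕ} {v : L.Val} :
      Step P (Act.inF h v) P' → Step Q (Act.outF h v) Q' →
      Step (par P Q) Act.tau (par P' Q')
  | comFR {P P' Q Q' : Proc L 0} {h : ℕ} {v : L.Val} :
      Step P (Act.outF h v) P' → Step Q (Act.inF h v) Q' →
      Step (par P Q) Act.tau (par P' Q')
  | condT {e f : Expr L 0} {P P' Q : Proc L 0} {μ : Act L} :
      e.eval = f.eval → Step P μ P' → Step (cond e f P Q) μ P'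
  | condF {e f : Expr L 0} {P Q Q' : Proc L 0} {μ : Act L} :
      e.eval ≠ f.eval → Step Q μ Q' → Step (cond e f P Q) μ Q'

/-- Reductions `P ⟶ P'`. -/
def Red (P P' : Proc L 0) : Prop := Step P Act.tau P'

/-- Weak reductions `P ⟹ P'`. -/
def Reds : Proc L 0 → Proc L 0 → Prop := Relation.ReflTransGen Red

/-- Weak barbs `P ⇓ω`. -/
def WeakBarb (P : Proc L 0) (ω : ℕ) : Prop :=
  ∃ P', Reds P P' ∧ ∃ P'', Step P' (Act.succ ω) P''

structure IsBarbedBisimulation (R : Proc L 0 → Proc L 0 → Prop) : Prop where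
  symm : ∀ P Q, R P Q → R Q P
  red : ∀ P Q, R P Q → ∀ P', Red P P' → ∃ Q', Reds Q Q' ∧ R P' Q'
  barb : ∀ P Q, R P Q → ∀ ω, WeakBarb P ω → WeakBarb Q ω

/-- Barbed bisimilarity. -/
def BarbedBisimilar (P Q : Proc L 0) : Prop :=
  ∃ R : Proc L 0 → Proc L 0 → Prop, IsBarbedBisimulation R ∧ R P Q

end Semantics

/-- The set of names `S`, seen below a binder of a higher-order name. -/
def shiftSet (S : Finset ℕ) : Finset ℕ := S.image Nat.succ

/-- The set `S` of names below a binder of a higher-order name, without the bound name, seen from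
outside of the binder. -/
def unshiftSet (S : Finset ℕ) : Finset ℕ := (S.erase 0).image Nat.pred

/-- The set `S` of names together with a fresh name, which becomes the name `0`. -/
def addFresh (S : Finset ℕ) : Finset ℕ := insert 0 (shiftSet S)

/-- Visibility functions: finite, transitive partial functions from higher-order names and the
token `cur` to finite sets of higher-order names; `cur` is the value at the token (`none` if
undefined), and `vis a` the value at the name `a`. -/
@[ext] structure VisFun where
  cur : Option (Finset ℕ)
  vis : ℕ → Option (Finset ℕ)
  finite_dom : {a | vis a ≠ none}.Finite
  trans_cur : ∀ S ∈ cur, ∀ a ∈ S, ∀ T ∈ vis a, T ⊆ S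
  trans_vis : ∀ o, ∀ S ∈ vis o, ∀ a ∈ S, ∀ T ∈ vis a, T ⊆ S

theorem succ_mem_shiftSet {S : Finset ℕ} {k : ℕ} : k + 1 ∈ shiftSet S ↔ k ∈ S := by
  simp [shiftSet]

theorem succ_mem_addFresh {S : Finset ℕ} {k : ℕ} : k + 1 ∈ addFresh S ↔ k ∈ S := by
  simp [addFresh, shiftSet]

theorem shiftSet_subset_addFresh {S T : Finset ℕ} (h : T ⊆ S) : shiftSet T ⊆ addFresh S :=
  (Finset.image_subset_image h).trans (Finset.subset_insert _ _)

theorem mem_unshiftSet {S : Finset ℕ} {k : ℕ} : k ∈ unshiftSet S ↔ k + 1 ∈ S := by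
  simp only [unshiftSet, Finset.mem_image, Finset.mem_erase]
  constructor
  · rintro ⟨m, ⟨h0, hm⟩, rfl⟩
    rwa [← Nat.succ_eq_add_one, Nat.succ_pred h0]
  · intro h
    exact ⟨k + 1, ⟨Nat.succ_ne_zero k, h⟩, rfl⟩

namespace VisFun

/-- The values of `Γ` at names, seen below a binder of a higher-order name, with the value `S` at
the bound name `0`. -/
def shiftVis (Γ : VisFun) (S : Option (Finset ℕ)) : ℕ → Option (Finset ℕ)
  | 0 => S
  | k + 1 => (Γ.vis k).map shiftSet

theorem shiftVis_finite (Γ : VisFun) (S : Option (Finset ℕ)) :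
    {a | Γ.shiftVis S a ≠ none}.Finite := by
  refine ((Γ.finite_dom.image Nat.succ).insert 0).subset ?_
  rintro (_ | k) hk
  · exact Set.mem_insert _ _
  · refine Set.mem_insert_of_mem _ ⟨k, ?_, rfl⟩
    intro h
    exact hk (by simp [shiftVis, h])

theorem shiftVis_trans (Γ : VisFun) {k : ℕ} {S U : Finset ℕ} {X : Option (Finset ℕ)}
    (hU : U ∈ Γ.vis k) (hS : S = shiftSet U) :
    ∀ a ∈ S, ∀ T ∈ Γ.shiftVis X a, T ⊆ S := by
  subst hS
  rintro (_ | a) ha T hT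
  · simp [shiftSet] at ha
  · simp only [shiftVis, Option.mem_def, Option.map_eq_some_iff] at hT
    obtain ⟨T', hT', rfl⟩ := hT
    exact Finset.image_subset_image (Γ.trans_vis k U hU a (succ_mem_shiftSet.1 ha) T' hT')

/-- `Γ, cur ↦ Γ(a) ∪ {b}`, where `b` is a fresh name, which becomes the name `0`
(used when `Γ(a)` is defined and `Γ(cur)` is not). -/
def acquire (Γ : VisFun) (a : ℕ) : VisFun where
  cur := (Γ.vis a).map addFresh
  vis := Γ.shiftVis none
  finite_dom := Γ.shiftVis_finite none
  trans_cur := by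
    intro S hS
    simp only [Option.mem_def, Option.map_eq_some_iff] at hS
    obtain ⟨U, hU, rfl⟩ := hS
    rintro (_ | c) hc T hT
    · simp [shiftVis] at hT
    · simp only [shiftVis, Option.mem_def, Option.map_eq_some_iff] at hT
      obtain ⟨T', hT', rfl⟩ := hT
      exact shiftSet_subset_addFresh (Γ.trans_vis a U hU c (succ_mem_addFresh.1 hc) T' hT')
  trans_vis := by
    rintro (_ | k) S hS
    · simp [shiftVis] at hS
    · simp only [shiftVis, Option.mem_def, Option.map_eq_some_iff] at hS
      obtain ⟨U, hU, rfl⟩ := hS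
      exact Γ.shiftVis_trans hU rfl

/-- `Γ ∖ cur, b ↦ Γ(cur) ∪ {b}`, where `b` is a fresh name, which becomes the name `0`
(used when `Γ(cur)` is defined). -/
def release (Γ : VisFun) : VisFun where
  cur := none
  vis := Γ.shiftVis (Γ.cur.map addFresh)
  finite_dom := Γ.shiftVis_finite _
  trans_cur := by simp
  trans_vis := by
    rintro (_ | k) S hS
    · simp only [shiftVis, Option.mem_def, Option.map_eq_some_iff] at hS
      obtain ⟨U, hU, rfl⟩ := hS
      rintro (_ | c) hc T hT
      · simp only [shiftVis, Option.mem_def, Option.map_eq_some_iff] at hT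
        obtain ⟨T', hT', rfl⟩ := hT
        rw [hU] at hT'
        cases hT'
        exact Finset.Subset.refl _
      · simp only [shiftVis, Option.mem_def, Option.map_eq_some_iff] at hT
        obtain ⟨T', hT', rfl⟩ := hT
        exact shiftSet_subset_addFresh (Γ.trans_cur U hU c (succ_mem_addFresh.1 hc) T' hT')
    · simp only [shiftVis, Option.mem_def, Option.map_eq_some_iff] at hS
      obtain ⟨U, hU, rfl⟩ := hS
      exact Γ.shiftVis_trans hU rfl

/-- `Γ ∖ a`, where `a` is the name `0`, erased in the domain and in the codomain; the result is
seen from outside of the binder of `a`. -/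
def erase (Γ : VisFun) : VisFun where
  cur := Γ.cur.map unshiftSet
  vis k := (Γ.vis (k + 1)).map unshiftSet
  finite_dom := by
    refine (Γ.finite_dom.preimage (f := Nat.succ) Nat.succ_injective.injOn).subset ?_
    intro k hk h
    exact hk (by simp [h])
  trans_cur := by
    intro S hS a ha T hT
    simp only [Option.mem_def, Option.map_eq_some_iff] at hS hT
    obtain ⟨U, hU, rfl⟩ := hS
    obtain ⟨T', hT', rfl⟩ := hT
    intro k hk
    rw [mem_unshiftSet] at ha hk ⊢
    exact Γ.trans_cur U hU _ ha T' hT' hk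
  trans_vis := by
    intro o S hS a ha T hT
    simp only [Option.mem_def, Option.map_eq_some_iff] at hS hT
    obtain ⟨U, hU, rfl⟩ := hS
    obtain ⟨T', hT', rfl⟩ := hT
    intro k hk
    rw [mem_unshiftSet] at ha hk ⊢
    exact Γ.trans_vis _ U hU _ ha T' hT' hk

/-- Compatibility: not both are defined at `cur`. -/
def Compatible (Γ₁ Γ₂ : VisFun) : Prop := Γ₁.cur = none ∨ Γ₂.cur = none

/-- `(Γ₁, Γ₂) ∈ split(Γ)`: `Γ` is the union of `Γ₁` and `Γ₂`, and these are not both defined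
at `cur`. -/
structure Split (Γ Γ₁ Γ₂ : VisFun) : Prop where
  cur_eq : Γ.cur = Option.merge (· ∪ ·) Γ₁.cur Γ₂.cur
  vis_eq : ∀ a, Γ.vis a = Option.merge (· ∪ ·) (Γ₁.vis a) (Γ₂.vis a)
  compatible : Compatible Γ₁ Γ₂

end VisFun

section Typing

variable {L : ExprLang.{u}}

open Proc

/-- The type system for visibility: `Typed Γ P` is `Γ ⊢ P`. -/
inductive Typed : {n : ℕ} → VisFun → Proc L n → Prop
  | outH {n : ℕ} {Γ : VisFun} {S : Finset ℕ} {a : ℕ} {e : Expr L n} {P : Proc L n} :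
      Γ.cur = some S → a ∈ S → Typed Γ.release P → Typed Γ (outH a e P)
  | inH {n : ℕ} {Γ : VisFun} {a : ℕ} {P : Proc L (n + 1)} :
      Γ.cur = none → Γ.vis a ≠ none → Typed (Γ.acquire a) P → Typed Γ (inH a P)
  | outF {n : ℕ} {Γ : VisFun} {h : ℕ} {e : Expr L n} {P : Proc L n} :
      Typed Γ P → Γ.cur = none → Typed Γ (outF h e P)
  | inF {n : ℕ} {Γ : VisFun} {h : ℕ} {P : Proc L (n + 1)} :
      Typed Γ P → Γ.cur ≠ none → Typed Γ (inF h P)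
  | repH {n : ℕ} {Γ : VisFun} {a : ℕ} {P : Proc L (n + 1)} :
      Typed Γ (inH a P) → Γ.cur = none → Typed Γ (repH a P)
  | repF {n : ℕ} {Γ : VisFun} {h : ℕ} {P : Proc L (n + 1)} :
      Typed Γ (inF h P) → Γ.cur = none → Typed Γ (repF h P)
  | succ {n : ℕ} {Γ : VisFun} {ω : ℕ} {P : Proc L n} : Typed Γ (succ ω P)
  | resH {n : ℕ} {Γ Γ' : VisFun} {P : Proc L n} :
      Typed Γ' P → Γ'.erase = Γ → Typed Γ (resH P)
  | resF {n : ℕ} {Γ : VisFun} {P : Proc L n} : Typed Γ P → Typed Γ (resF P)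
  | nil {n : ℕ} {Γ : VisFun} : Γ.cur = none → Typed Γ (nil : Proc L n)
  | sum {n : ℕ} {Γ : VisFun} {P Q : Proc L n} :
      Typed Γ P → Typed Γ Q → Typed Γ (sum P Q)
  | par {n : ℕ} {Γ Γ₁ Γ₂ : VisFun} {P Q : Proc L n} :
      Typed Γ₁ P → Typed Γ₂ Q → VisFun.Split Γ Γ₁ Γ₂ → Typed Γ (par P Q)
  | cond {n : ℕ} {Γ : VisFun} {e f : Expr L n} {P Q : Proc L n} :
      Typed Γ P → Typed Γ Q → Typed Γ (cond e f P Q)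

/-- Barbed equivalence at `Γ` of the `Δ`-processes `P` and `Q`, where `Δ` and `Γ` are compatible;
open processes are compared under all closing substitutions. -/
structure BarbedEquiv {n : ℕ} (Δ Γ : VisFun) (P Q : Proc L n) : Prop where
  compatible : VisFun.Compatible Δ Γ
  typed_left : Typed Δ P
  typed_right : Typed Δ Q
  equiv : ∀ (σ : Fin n → L.Val) (R : Proc L 0), Typed Γ R →
    BarbedBisimilar (par (P.close σ) R) (par (Q.close σ) R)

/-- The type-allowed transitions: `VStep Γ P μ Γ' P'` says that an observer with visibility `Γ`
allows `P` to make the transition `μ` to `P'`, whereby its visibility becomes `Γ'`. -/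
inductive VStep : VisFun → Proc L 0 → Act L → VisFun → Proc L 0 → Prop
  | outH {Γ : VisFun} {P P' : Proc L 0} {a : ℕ} {v : L.Val} :
      Step P (Act.outH a v) P' → Γ.vis a ≠ none → Γ.cur = none →
      VStep Γ P (Act.outH a v) (Γ.acquire a) P'
  | inH {Γ : VisFun} {S : Finset ℕ} {P P' : Proc L 0} {a : ℕ} {v : L.Val} :
      Step P (Act.inH a v) P' → Γ.cur = some S → a ∈ S →
      VStep Γ P (Act.inH a v) Γ.release P'
  | outF {Γ : VisFun} {P P' : Proc L 0} {h : ℕ} {v : L.Val} :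
      Step P (Act.outF h v) P' → Γ.cur ≠ none → VStep Γ P (Act.outF h v) Γ P'
  | inF {Γ : VisFun} {P P' : Proc L 0} {h : ℕ} {v : L.Val} :
      Step P (Act.inF h v) P' → Γ.cur = none → VStep Γ P (Act.inF h v) Γ P'
  | tau {Γ : VisFun} {P P' : Proc L 0} :
      Step P Act.tau P' → Γ.cur = none → VStep Γ P Act.tau Γ P'

/-- The weak type-allowed reductions of a process, for the observer visibility `Γ`. -/
def VReds (Γ : VisFun) : Proc L 0 → Proc L 0 → Prop :=
  Relation.ReflTransGen (fun P P' => VStep Γ P Act.tau Γ P')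

/-- The weak type-allowed transitions: zero or more reductions if `μ` is `τ`, and `μ` preceded and
followed by zero or more reductions otherwise. -/
inductive WeakVStep : VisFun → Proc L 0 → Act L → VisFun → Proc L 0 → Prop
  | tau {Γ : VisFun} {P P' : Proc L 0} : VReds Γ P P' → WeakVStep Γ P Act.tau Γ P'
  | act {Γ Γ' : VisFun} {P P₁ P₂ P' : Proc L 0} {μ : Act L} :
      μ ≠ Act.tau → VReds Γ P P₁ → VStep Γ P₁ μ Γ' P₂ → VReds Γ' P₂ P' →
      WeakVStep Γ P μ Γ' P'

structure IsTypedBisimulation (R : VisFun → Proc L 0 → Proc L 0 → Prop) : Prop where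
  left : ∀ Γ P Q, R Γ P Q → ∀ μ Γ' P', VStep Γ P μ Γ' P' →
    ∃ Q', WeakVStep Γ Q μ Γ' Q' ∧ R Γ' P' Q'
  right : ∀ Γ P Q, R Γ P Q → ∀ μ Γ' Q', VStep Γ Q μ Γ' Q' →
    ∃ P', WeakVStep Γ P μ Γ' P' ∧ R Γ' P' Q'

/-- Typed bisimilarity, on closed processes. -/
def TypedBisimilar (Γ : VisFun) (P Q : Proc L 0) : Prop :=
  ∃ R : VisFun → Proc L 0 → Proc L 0 → Prop, IsTypedBisimulation R ∧ R Γ P Q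

/-- The `Δ`-processes `P` and `Q` are bisimilar under `Γ`, where `Δ` and `Γ` are compatible; open
processes are compared under all closing substitutions. -/
structure BisimilarUnder {n : ℕ} (Δ Γ : VisFun) (P Q : Proc L n) : Prop where
  compatible : VisFun.Compatible Δ Γ
  typed_left : Typed Δ P
  typed_right : Typed Δ Q
  bisim : ∀ σ : Fin n → L.Val, TypedBisimilar Γ (P.close σ) (Q.close σ)

/-- `Derivative Γ P Γ' P'`: a (possibly empty) sequence of type-allowed transitions leads from `P`
under `Γ` to `P'` under `Γ'`. -/
inductive Derivative (Γ : VisFun) (P : Proc L 0) : VisFun → Proc L 0 → Prop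
  | refl : Derivative Γ P Γ P
  | tail {Γ₁ Γ₂ : VisFun} {P₁ P₂ : Proc L 0} {μ : Act L} :
      Derivative Γ P Γ₁ P₁ → VStep Γ₁ P₁ μ Γ₂ P₂ → Derivative Γ P Γ₂ P₂

/-- `P` is image-finite under `Γ`: from each derivative, each action leads by weak type-allowed
transitions to only finitely many processes. -/
def ImageFinite {n : ℕ} (Γ : VisFun) (P : Proc L n) : Prop :=
  ∀ (σ : Fin n → L.Val) (Γ' : VisFun) (P' : Proc L 0), Derivative Γ (P.close σ) Γ' P' →
    ∀ μ : Act L, {P'' | ∃ Γ'', WeakVStep Γ' P' μ Γ'' P''}.Finite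

end Typing

end VPi

/-! Soundness: typed bisimilarity is preserved by putting a well-typed observer in parallel. At most
one of process and observer holds `cur`, and subject reduction (`Typed.step`) says which actions
each of them can then perform. Hence a communication between a process and an observer with
compatible visibilities is always type-allowed, and the observer afterwards is typed by the updated
visibility (`CoTyped.exists_vStep`). So the pairs `(P | R, Q | R)` with `P`, `Q` bisimilar, closed
under the restrictions created by communication (`BisimContext`), form a barbed bisimulation; barbs
come from `R` alone because `P` and `Q` have no success names. Subject reduction rests on invariance
of typing under renaming and enlargement of visibilities (`Typed.renH`), whose difficult case is
restriction (`Embeds.exists_erase`).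

Completeness: barbed equivalence is itself a typed bisimulation (`Indistinguishable.vStep`). Suppose
that a `μ`-transition of `P` to `P'` has no match. By image-finiteness `Q` has finitely many weak
`μ`-derivatives, each separated from `P'` by some observer. These observers are combined into one by
menus, sums `(R₁ | ω₁.0) + (R₂ | ω₂.0)` with fresh success names: while both barbs are present no
choice has been made, and a choice destroys one of them for good. Hence equivalence in the presence
of the menu implies equivalence in the presence of each item (`Menu.left`). A test that offers the
dual of `μ` before the menu forces `Q` to perform `μ` (`IsTest.exists_weakVStep`), a contradiction.

In this direction `P` and `Q` may contain success names. Therefore only barbs in a set `O` of names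
that do not occur in `P` and `Q` are compared; as transitions create no success names, `O` can be
fixed once and for all. -/

namespace VPi

universe u

/-! ### Embeddings and extensions of visibility functions -/

namespace VisFun

/-- The value of `Γ` at the token `cur`, written `none`, or at a name. -/
def val (Γ : VisFun) : Option ℕ → Option (Finset ℕ)
  | none => Γ.cur
  | some a => Γ.vis a

theorem val_trans (Γ : VisFun) {o : Option ℕ} {S : Finset ℕ} (hS : Γ.val o = some S) {a : ℕ}
    (ha : a ∈ S) {T : Finset ℕ} (hT : Γ.vis a = some T) : T ⊆ S := by
  cases o with
  | none => exact Γ.trans_cur S hS a ha T hT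
  | some o => exact Γ.trans_vis o S hS a ha T hT

/-- `Γ ∖ cur` -/
def passive (Γ : VisFun) : VisFun where
  cur := none
  vis := Γ.vis
  finite_dom := Γ.finite_dom
  trans_cur := by simp
  trans_vis := Γ.trans_vis

theorem passive_eq_self {Γ : VisFun} (h : Γ.cur = none) : Γ.passive = Γ :=
  VisFun.ext h.symm rfl

theorem split_passive_right (Γ : VisFun) : Split Γ Γ Γ.passive where
  cur_eq := by cases h : Γ.cur <;> simp [passive]
  vis_eq a := by cases h : Γ.vis a <;> simp [passive, h]
  compatible := Or.inr rfl

theorem split_passive_left (Γ : VisFun) : Split Γ Γ.passive Γ where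
  cur_eq := by cases h : Γ.cur <;> simp [passive]
  vis_eq a := by cases h : Γ.vis a <;> simp [passive, h]
  compatible := Or.inl rfl

/-- `Γ'` has, up to the renaming `f`, at least the visibilities of `Γ`, and is not defined at `cur`
unless `Γ` is. -/
structure Embeds (f : ℕ → ℕ) (Γ Γ' : VisFun) : Prop where
  cur_none : Γ.cur = none → Γ'.cur = none
  le : ∀ o S, Γ.val o = some S → ∃ S', Γ'.val (o.map f) = some S' ∧ ∀ a ∈ S, f a ∈ S'

theorem Embeds.cur_ne_none {f : ℕ → ℕ} {Γ Γ' : VisFun} (h : Embeds f Γ Γ') (hc : Γ.cur ≠ none) :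
    Γ'.cur ≠ none := by
  obtain ⟨S, hS⟩ := Option.ne_none_iff_exists'.1 hc
  obtain ⟨S', hS', -⟩ := h.le none S hS
  simp only [Option.map_none, val] at hS'
  simp [hS']

theorem Embeds.vis_ne_none {f : ℕ → ℕ} {Γ Γ' : VisFun} (h : Embeds f Γ Γ') {a : ℕ}
    (ha : Γ.vis a ≠ none) : Γ'.vis (f a) ≠ none := by
  obtain ⟨S, hS⟩ := Option.ne_none_iff_exists'.1 ha
  obtain ⟨S', hS', -⟩ := h.le (some a) S hS
  simp only [Option.map_some, val] at hS'
  simp [hS']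

theorem upRen_mem_addFresh {f : ℕ → ℕ} {S S' : Finset ℕ} (h : ∀ a ∈ S, f a ∈ S') :
    ∀ a ∈ addFresh S, upRen f a ∈ addFresh S'
  | 0, _ => Finset.mem_insert_self _ _
  | _ + 1, ha => succ_mem_addFresh.2 (h _ (succ_mem_addFresh.1 ha))

theorem upRen_mem_shiftSet {f : ℕ → ℕ} {S S' : Finset ℕ} (h : ∀ a ∈ S, f a ∈ S') :
    ∀ a ∈ shiftSet S, upRen f a ∈ shiftSet S'
  | 0, ha => by simp [shiftSet] at ha
  | _ + 1, ha => succ_mem_shiftSet.2 (h _ (succ_mem_shiftSet.1 ha))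

theorem Embeds.vis_succ {f : ℕ → ℕ} {Γ Γ' : VisFun} (h : Embeds f Γ Γ') {k : ℕ} {S : Finset ℕ}
    (hS : (Γ.vis k).map shiftSet = some S) :
    ∃ S', (Γ'.vis (f k)).map shiftSet = some S' ∧ ∀ a ∈ S, upRen f a ∈ S' := by
  obtain ⟨U, hU, rfl⟩ := Option.map_eq_some_iff.1 hS
  obtain ⟨U', hU', hf⟩ := h.le (some k) U hU
  simp only [Option.map_some, val] at hU'
  exact ⟨_, by rw [hU']; rfl, upRen_mem_shiftSet hf⟩

theorem Embeds.release {f : ℕ → ℕ} {Γ Γ' : VisFun} (h : Embeds f Γ Γ') :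
    Embeds (upRen f) Γ.release Γ'.release where
  cur_none _ := rfl
  le := by
    rintro (_ | _ | k) S hS
    · cases hS
    · obtain ⟨U, hU, rfl⟩ := Option.map_eq_some_iff.1 hS
      obtain ⟨U', hU', hf⟩ := h.le none U hU
      simp only [Option.map_none, val] at hU'
      exact ⟨addFresh U', by simp [val, upRen, VisFun.release, shiftVis, hU'],
        upRen_mem_addFresh hf⟩
    · exact h.vis_succ hS

theorem Embeds.acquire {f : ℕ → ℕ} {Γ Γ' : VisFun} (h : Embeds f Γ Γ') {a : ℕ}
    (ha : Γ.vis a ≠ none) : Embeds (upRen f) (Γ.acquire a) (Γ'.acquire (f a)) where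
  cur_none hc := absurd (Option.map_eq_none_iff.1 hc) ha
  le := by
    rintro (_ | _ | k) S hS
    · obtain ⟨U, hU, rfl⟩ := Option.map_eq_some_iff.1 hS
      obtain ⟨U', hU', hf⟩ := h.le (some a) U hU
      simp only [Option.map_some, val] at hU'
      exact ⟨addFresh U', by simp [val, VisFun.acquire, hU'], upRen_mem_addFresh hf⟩
    · cases hS
    · exact h.vis_succ hS

/-- The set of names `S` below the binder of a name with visibility `X`: the bound name is added
whenever transitivity permits. -/
def augment (X : Option (Finset ℕ)) (S : Finset ℕ) : Finset ℕ :=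
  open Classical in if ∀ Y ∈ X, Y ⊆ S then addFresh S else shiftSet S

theorem succ_mem_augment {X : Option (Finset ℕ)} {S : Finset ℕ} {k : ℕ} :
    k + 1 ∈ augment X S ↔ k ∈ S := by
  unfold augment
  split_ifs
  · exact succ_mem_addFresh
  · exact succ_mem_shiftSet

theorem zero_mem_augment {X : Option (Finset ℕ)} {S : Finset ℕ} :
    0 ∈ augment X S ↔ ∀ Y ∈ X, Y ⊆ S := by
  unfold augment
  split_ifs with h
  · simpa [addFresh] using h
  · simpa [shiftSet] using h

theorem unshiftSet_augment (X : Option (Finset ℕ)) (S : Finset ℕ) :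
    unshiftSet (augment X S) = S := by
  ext k
  rw [mem_unshiftSet, succ_mem_augment]

/-- The bound name enters only sets that contain `X`, so transitivity through it holds; it enters
all of them, hence every superset of a set that it enters, so transitivity through the old names
survives. -/
theorem augment_trans {Γ : VisFun} {X : Option (Finset ℕ)} {o : Option ℕ} {U : Finset ℕ}
    (hU : Γ.val o = some U) {a : ℕ} (ha : a ∈ augment X U) {T : Finset ℕ}
    (hT : (Nat.casesOn a (X.map addFresh) (fun k => (Γ.vis k).map (augment X)) :
      Option (Finset ℕ)) = some T) : T ⊆ augment X U := by
  rcases a with _ | a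
  · obtain ⟨Y, hY, rfl⟩ := Option.map_eq_some_iff.1 hT
    rintro (_ | k) hk
    · exact ha
    · exact succ_mem_augment.2 (zero_mem_augment.1 ha Y hY (succ_mem_addFresh.1 hk))
  · obtain ⟨V, hV, rfl⟩ := Option.map_eq_some_iff.1 hT
    have hVU : V ⊆ U := Γ.val_trans hU (succ_mem_augment.1 ha) hV
    rintro (_ | k) hk
    · exact zero_mem_augment.2 fun Y hY => (zero_mem_augment.1 hk Y hY).trans hVU
    · exact succ_mem_augment.2 (hVU (succ_mem_augment.1 hk))

/-- The largest extension of `Γ` to a name `0` with visibility `X`. -/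
def extend (Γ : VisFun) (X : Option (Finset ℕ))
    (hX : ∀ Y ∈ X, ∀ c ∈ Y, ∀ T ∈ Γ.vis c, T ⊆ Y) : VisFun where
  cur := Γ.cur.map (augment X)
  vis a := Nat.casesOn a (X.map addFresh) (fun k => (Γ.vis k).map (augment X))
  finite_dom := by
    refine ((Γ.finite_dom.image Nat.succ).insert 0).subset ?_
    rintro (_ | k) hk
    · exact Set.mem_insert _ _
    · refine Set.mem_insert_of_mem _ ⟨k, fun h => hk ?_, rfl⟩
      simp [h]
  trans_cur := by
    intro S hS a ha T hT
    obtain ⟨U, hU, rfl⟩ := Option.map_eq_some_iff.1 hS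
    exact augment_trans (o := none) hU ha hT
  trans_vis := by
    rintro (_ | o) S hS a ha T hT
    · obtain ⟨Y, hY, rfl⟩ := Option.map_eq_some_iff.1 hS
      rcases a with _ | a
      · rw [Option.mem_def] at hT
        rw [hS] at hT
        exact (Option.some.inj hT).ge
      · obtain ⟨V, hV, rfl⟩ := Option.map_eq_some_iff.1 hT
        rintro (_ | k) hk
        · exact Finset.mem_insert_self _ _
        · exact succ_mem_addFresh.2 (hX Y hY a (succ_mem_addFresh.1 ha) V hV
            (succ_mem_augment.1 hk))
    · obtain ⟨U, hU, rfl⟩ := Option.map_eq_some_iff.1 hS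
      exact augment_trans (o := some o) hU ha hT

theorem erase_extend (Γ : VisFun) (X : Option (Finset ℕ))
    (hX : ∀ Y ∈ X, ∀ c ∈ Y, ∀ T ∈ Γ.vis c, T ⊆ Y) : (Γ.extend X hX).erase = Γ := by
  have h : unshiftSet ∘ augment X = id := funext (unshiftSet_augment X)
  refine VisFun.ext ?_ (funext fun k => ?_)
  · simp [erase, extend, h]
  · simp [erase, extend, h]

/-- The restriction rule asks for a visibility function whose erasure is exactly `Γ'`, so enlarging
the outside must be lifted below the binder. The bound name receives the smallest admissible
visibility and is then added to as many sets as transitivity permits. -/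
theorem Embeds.exists_erase {f : ℕ → ℕ} {Γ₀ Γ' : VisFun} (h : Embeds f Γ₀.erase Γ') :
    ∃ Γ₀' : VisFun, Γ₀'.erase = Γ' ∧ Embeds (upRen f) Γ₀ Γ₀' := by
  let W : Finset ℕ → Finset ℕ := fun U => (unshiftSet U).image f
  -- The image of the old visibility need not be closed under `Γ'`; one round of closure is enough
  -- since `Γ'` is transitive.
  let X := (Γ₀.vis 0).map fun U => W U ∪ (W U).biUnion fun c => (Γ'.vis c).getD ∅
  have hX : ∀ Y ∈ X, ∀ c ∈ Y, ∀ T ∈ Γ'.vis c, T ⊆ Y := by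
    intro Y hY c hc T hT
    obtain ⟨U, hU, rfl⟩ := Option.map_eq_some_iff.1 hY
    rcases Finset.mem_union.1 hc with hc | hc
    · refine Finset.Subset.trans ?_ Finset.subset_union_right
      refine Finset.Subset.trans ?_ (Finset.subset_biUnion_of_mem _ hc)
      rw [Option.mem_def] at hT
      simp [hT]
    · obtain ⟨d, hd, hcd⟩ := Finset.mem_biUnion.1 hc
      refine Finset.Subset.trans ?_ Finset.subset_union_right
      refine Finset.Subset.trans ?_ (Finset.subset_biUnion_of_mem _ hd)
      cases hV : Γ'.vis d with
      | none => simp [hV] at hcd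
      | some V => exact Γ'.trans_vis d V hV c (by simpa [hV] using hcd) T hT
  -- If `S` contains the bound name, it contains all that is visible from it; so `S'` contains `X`,
  -- and `augment` does add the bound name.
  have key : ∀ (o : Option ℕ) (S S' : Finset ℕ), Γ₀.val (o.map Nat.succ) = some S →
      Γ'.val (o.map f) = some S' → (∀ a ∈ unshiftSet S, f a ∈ S') →
      ∀ a ∈ S, upRen f a ∈ augment X S' := by
    rintro o S S' hS hS' hf (_ | a) ha
    · refine zero_mem_augment.2 fun Y hY => ?_
      obtain ⟨U, hU, rfl⟩ := Option.map_eq_some_iff.1 hY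
      have hW : W U ⊆ S' := by
        refine Finset.image_subset_iff.2 fun c hc => hf c ?_
        rw [mem_unshiftSet] at hc ⊢
        exact Γ₀.val_trans hS ha hU hc
      refine Finset.union_subset hW (Finset.biUnion_subset.2 fun c hc => ?_)
      cases hV : Γ'.vis c with
      | none => simp
      | some V => exact Γ'.val_trans hS' (hW hc) hV
    · exact succ_mem_augment.2 (hf a (mem_unshiftSet.2 ha))
  refine ⟨Γ'.extend X hX, erase_extend _ _ _, ⟨fun hc => ?_, ?_⟩⟩
  · have : Γ'.cur = none := h.cur_none (by simp [erase, hc])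
    simp [extend, this]
  · rintro (_ | _ | k) S hS
    · obtain ⟨S', hS', hf⟩ := h.le none (unshiftSet S) (by
        simp only [val] at hS ⊢; simp [erase, hS])
      refine ⟨augment X S', ?_, key none S S' hS hS' hf⟩
      simp only [Option.map_none, val] at hS' ⊢
      simp [extend, hS']
    · refine ⟨addFresh (W S ∪ (W S).biUnion fun c => (Γ'.vis c).getD ∅), ?_, ?_⟩
      · simp only [val] at hS
        simp [val, upRen, extend, X, hS]
      · rintro (_ | a) ha
        · exact Finset.mem_insert_self _ _
        · refine succ_mem_addFresh.2 (Finset.mem_union_left _ ?_)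
          exact Finset.mem_image_of_mem f (mem_unshiftSet.2 ha)
    · obtain ⟨S', hS', hf⟩ := h.le (some k) (unshiftSet S) (by
        simp only [val] at hS ⊢; simp [erase, hS])
      refine ⟨augment X S', ?_, key (some k) S S' hS hS' hf⟩
      simp only [Option.map_some, val] at hS' ⊢
      simp [extend, upRen, hS']

/-- Only `cur` is a linear resource. The visibilities of names can be given in full to both
components, so a split merely decides who holds `cur`. -/
theorem Embeds.split {f : ℕ → ℕ} {Γ Γ₁ Γ₂ Γ' : VisFun} (h : Embeds f Γ Γ') (hs : Split Γ Γ₁ Γ₂) :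
    (Embeds f Γ₁ Γ' ∧ Embeds f Γ₂ Γ'.passive) ∨ (Embeds f Γ₁ Γ'.passive ∧ Embeds f Γ₂ Γ') := by
  have hvis : ∀ a S, (Γ₁.vis a = some S ∨ Γ₂.vis a = some S) →
      ∃ S', Γ'.vis (f a) = some S' ∧ ∀ a ∈ S, f a ∈ S' := by
    intro a S hS
    have : ∃ U, Γ.vis a = some U ∧ S ⊆ U := by
      rw [hs.vis_eq a]
      rcases hS with hS | hS <;> rw [hS]
      · cases Γ₂.vis a
        · exact ⟨S, rfl, subset_rfl⟩
        · exact ⟨_, rfl, Finset.subset_union_left⟩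
      · cases Γ₁.vis a
        · exact ⟨S, rfl, subset_rfl⟩
        · exact ⟨_, rfl, Finset.subset_union_right⟩
    obtain ⟨U, hU, hSU⟩ := this
    obtain ⟨S', hS', hf⟩ := h.le (some a) U hU
    exact ⟨S', hS', fun a ha => hf a (hSU ha)⟩
  rcases hs.compatible with h1 | h2
  · refine Or.inr ⟨⟨fun _ => rfl, ?_⟩, ⟨fun hc => h.cur_none (by rw [hs.cur_eq, h1, hc]; rfl), ?_⟩⟩
    · rintro (_ | a) S hS
      · simp [val, h1] at hS
      · exact hvis a S (Or.inl hS)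
    · rintro (_ | a) S hS
      · refine h.le none S ?_
        simp only [val] at hS ⊢
        rw [hs.cur_eq, h1, hS]; rfl
      · exact hvis a S (Or.inr hS)
  · refine Or.inl ⟨⟨fun hc => h.cur_none (by rw [hs.cur_eq, h2, hc]; rfl), ?_⟩, ⟨fun _ => rfl, ?_⟩⟩
    · rintro (_ | a) S hS
      · refine h.le none S ?_
        simp only [val] at hS ⊢
        rw [hs.cur_eq, h2, hS]; rfl
      · exact hvis a S (Or.inl hS)
    · rintro (_ | a) S hS
      · simp [val, h2] at hS
      · exact hvis a S (Or.inr hS)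

end VisFun

/-! ### Typing under renaming, weakening and substitution -/

section Typing

variable {L : ExprLang.{u}}

open Proc VisFun

theorem Typed.renH {n : ℕ} {Γ : VisFun} {P : Proc L n} (hP : Typed Γ P) :
    ∀ {f : ℕ → ℕ} {Γ' : VisFun}, Embeds f Γ Γ' → Typed Γ' (P.renH f) := by
  induction hP with
  | outH hc ha _ ih =>
    intro f Γ' h
    obtain ⟨S', hS', hf⟩ := h.le none _ hc
    exact .outH hS' (hf _ ha) (ih h.release)
  | inH hc ha _ ih => exact fun h => .inH (h.cur_none hc) (h.vis_ne_none ha) (ih (h.acquire ha))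
  | outF _ hc ih => exact fun h => .outF (ih h) (h.cur_none hc)
  | inF _ hc ih => exact fun h => .inF (ih h) (h.cur_ne_none hc)
  | repH _ hc ih => exact fun h => .repH (ih h) (h.cur_none hc)
  | repF _ hc ih => exact fun h => .repF (ih h) (h.cur_none hc)
  | succ => exact fun _ => .succ
  | resH _ he ih =>
    intro f Γ' h
    subst he
    obtain ⟨Γ₀', rfl, h'⟩ := h.exists_erase
    exact .resH (ih h') rfl
  | resF _ ih => exact fun h => .resF (ih h)
  | nil hc => exact fun h => .nil (h.cur_none hc)
  | sum _ _ ihP ihQ => exact fun h => .sum (ihP h) (ihQ h)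
  | par _ _ hs ihP ihQ =>
    intro f Γ' h
    rcases h.split hs with ⟨h1, h2⟩ | ⟨h1, h2⟩
    · exact .par (ihP h1) (ihQ h2) (split_passive_right _)
    · exact .par (ihP h1) (ihQ h2) (split_passive_left _)
  | cond _ _ ihP ihQ => exact fun h => .cond (ihP h) (ihQ h)

theorem Proc.renH_id {n : ℕ} (P : Proc L n) : P.renH id = P := by
  have h : upRen id = id := by
    funext k; cases k <;> rfl
  induction P <;> simp_all [Proc.renH]

theorem Typed.weaken {n : ℕ} {Γ Γ' : VisFun} {P : Proc L n} (hP : Typed Γ P)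
    (h : Embeds id Γ Γ') : Typed Γ' P := by
  simpa [Proc.renH_id] using hP.renH h

theorem VisFun.Embeds.refl (Γ : VisFun) : Embeds id Γ Γ :=
  ⟨id, fun o S hS => ⟨S, by simpa using hS, fun _ h => h⟩⟩

/-- A normal form for typings of parallel compositions, which removes arbitrary splits from all
later arguments. -/
theorem Typed.par_cases {n : ℕ} {Γ : VisFun} {P Q : Proc L n} (h : Typed Γ (Proc.par P Q)) :
    (Typed Γ P ∧ Typed Γ.passive Q) ∨ (Typed Γ.passive P ∧ Typed Γ Q) := by
  cases h with
  | par hP hQ hs =>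
    exact ((Embeds.refl Γ).split hs).imp (fun h => ⟨hP.weaken h.1, hQ.weaken h.2⟩)
      (fun h => ⟨hP.weaken h.1, hQ.weaken h.2⟩)

theorem Typed.par_left {n : ℕ} {Γ : VisFun} {P Q : Proc L n} (hP : Typed Γ P)
    (hQ : Typed Γ.passive Q) : Typed Γ (Proc.par P Q) := .par hP hQ (split_passive_right Γ)

theorem Typed.par_right {n : ℕ} {Γ : VisFun} {P Q : Proc L n} (hP : Typed Γ.passive P)
    (hQ : Typed Γ Q) : Typed Γ (Proc.par P Q) := .par hP hQ (split_passive_left Γ)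

theorem Typed.subst {n : ℕ} {Γ : VisFun} {P : Proc L n} (hP : Typed Γ P) :
    ∀ {m : ℕ} (σ : Fin n → Expr L m), Typed Γ (P.subst σ) := by
  induction hP with
  | outH hc ha _ ih => exact fun σ => .outH hc ha (ih σ)
  | inH hc ha _ ih => exact fun σ => .inH hc ha (ih _)
  | outF _ hc ih => exact fun σ => .outF (ih σ) hc
  | inF _ hc ih => exact fun σ => .inF (ih _) hc
  | repH _ hc ih => exact fun σ => .repH (ih σ) hc
  | repF _ hc ih => exact fun σ => .repF (ih σ) hc
  | succ => exact fun _ => .succ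
  | resH _ he ih => exact fun σ => .resH (ih σ) he
  | resF _ ih => exact fun σ => .resF (ih σ)
  | nil hc => exact fun _ => .nil hc
  | sum _ _ ihP ihQ => exact fun σ => .sum (ihP σ) (ihQ σ)
  | par _ _ hs ihP ihQ => exact fun σ => .par (ihP σ) (ihQ σ) hs
  | cond _ _ ihP ihQ => exact fun σ => .cond (ihP σ) (ihQ σ)

end Typing

end VPi

namespace VPi

universe u

/-! ### The visibility of a process along its transitions -/

namespace VisFun

/-- The visibility function `Γ` with names permuted by `e`. -/
def permute (e : Equiv.Perm ℕ) (Γ : VisFun) : VisFun where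
  cur := Γ.cur.map (Finset.map e.toEmbedding)
  vis k := (Γ.vis (e.symm k)).map (Finset.map e.toEmbedding)
  finite_dom := by
    refine (Γ.finite_dom.preimage (f := e.symm) e.symm.injective.injOn).subset ?_
    intro k hk h
    exact hk (by simp [h])
  trans_cur := by
    intro S hS a ha T hT
    obtain ⟨U, hU, rfl⟩ := Option.map_eq_some_iff.1 hS
    obtain ⟨V, hV, rfl⟩ := Option.map_eq_some_iff.1 hT
    exact Finset.map_subset_map.2 (Γ.trans_cur U hU _ (Finset.mem_map_equiv.1 ha) V hV)
  trans_vis := by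
    intro o S hS a ha T hT
    obtain ⟨U, hU, rfl⟩ := Option.map_eq_some_iff.1 hS
    obtain ⟨V, hV, rfl⟩ := Option.map_eq_some_iff.1 hT
    exact Finset.map_subset_map.2 (Γ.trans_vis _ U hU _ (Finset.mem_map_equiv.1 ha) V hV)

theorem embeds_permute (e : Equiv.Perm ℕ) (Γ : VisFun) : Embeds e Γ (Γ.permute e) where
  cur_none h := by simp [permute, h]
  le := by
    rintro (_ | a) S hS <;> simp only [val] at hS <;>
    exact ⟨S.map e.toEmbedding, by simp [val, permute, hS], fun a ha => by simpa using ha⟩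

theorem unshiftSet_swap_addFresh (S : Finset ℕ) :
    unshiftSet ((addFresh S).map (Equiv.swap 0 1).toEmbedding) = addFresh (unshiftSet S) := by
  ext (_ | k)
  · simp [mem_unshiftSet, Finset.mem_map_equiv, addFresh]
  · rw [mem_unshiftSet, Finset.mem_map_equiv, succ_mem_addFresh, mem_unshiftSet, Equiv.symm_swap,
      Equiv.swap_apply_of_ne_of_ne (by simp) (by simp), succ_mem_addFresh]

theorem unshiftSet_swap_shiftSet (S : Finset ℕ) :
    unshiftSet ((shiftSet S).map (Equiv.swap 0 1).toEmbedding) = shiftSet (unshiftSet S) := by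
  ext (_ | k)
  · simp [mem_unshiftSet, Finset.mem_map_equiv, shiftSet]
  · rw [mem_unshiftSet, Finset.mem_map_equiv, succ_mem_shiftSet, mem_unshiftSet, Equiv.symm_swap,
      Equiv.swap_apply_of_ne_of_ne (by simp) (by simp), succ_mem_shiftSet]

/-- When an action that binds a name leaves a restriction, the transmitted and the restricted name
are `0` and `1`; the swap makes the restricted one innermost, so that erasure removes it and not the
other. -/
theorem erase_permute_shiftVis {Γ Γ' : VisFun} {X : Option (Finset ℕ)}
    (h : Γ'.vis = Γ.shiftVis (X.map addFresh)) :
    (Γ'.permute (Equiv.swap 0 1)).erase.vis =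
      Γ.erase.shiftVis ((X.map unshiftSet).map addFresh) := by
  funext k
  rcases k with _ | k
  · cases X <;> simp [erase, permute, h, shiftVis, unshiftSet_swap_addFresh]
  · have : Equiv.swap 0 1 (k + 2) = k + 2 :=
      Equiv.swap_apply_of_ne_of_ne (by simp) (by simp)
    cases hk : Γ.vis (k + 1) <;>
      simp [erase, permute, h, shiftVis, this, hk, unshiftSet_swap_shiftSet]

theorem erase_permute_acquire (Γ : VisFun) (a : ℕ) :
    ((Γ.acquire (a + 1)).permute (Equiv.swap 0 1)).erase = Γ.erase.acquire a := by
  refine VisFun.ext ?_ (erase_permute_shiftVis (X := none) rfl)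
  cases h : Γ.vis (a + 1) <;> simp [erase, permute, acquire, h, unshiftSet_swap_addFresh]

theorem erase_permute_release (Γ : VisFun) :
    (Γ.release.permute (Equiv.swap 0 1)).erase = Γ.erase.release :=
  VisFun.ext rfl (erase_permute_shiftVis (X := Γ.cur) rfl)

theorem embeds_succ_of_vis {Γ Γ' : VisFun} {X : Option (Finset ℕ)} (h : Γ'.vis = Γ.shiftVis X) :
    Embeds Nat.succ Γ.passive Γ'.passive where
  cur_none _ := rfl
  le := by
    rintro (_ | a) S hS
    · cases hS
    · exact ⟨shiftSet S, by simp only [val, passive] at hS; simp [val, passive, h, shiftVis, hS],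
        fun _ h => succ_mem_shiftSet.2 h⟩

/-- After a communication at a name visible from `cur`, the scope of the transmitted name can be
typed. -/
theorem exists_erase_of_mem_cur {Γ : VisFun} {S : Finset ℕ} {a : ℕ} (hS : Γ.cur = some S)
    (ha : a ∈ S) (hv : Γ.vis a ≠ none) : ∃ Γ' : VisFun, Γ'.erase = Γ ∧ Embeds id (Γ.acquire a) Γ' ∧
      Embeds id Γ.release Γ'.passive := by
  have hX : ∀ Y ∈ Γ.cur, ∀ c ∈ Y, ∀ T ∈ Γ.vis c, T ⊆ Y := Γ.trans_cur
  have hvis : ∀ k S, (Γ.vis k).map shiftSet = some S →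
      ∃ S', (Γ.vis k).map (augment Γ.cur) = some S' ∧ ∀ a ∈ S, a ∈ S' := by
    intro k S hS
    obtain ⟨U, hU, rfl⟩ := Option.map_eq_some_iff.1 hS
    refine ⟨augment Γ.cur U, by rw [hU]; rfl, ?_⟩
    rintro (_ | b) hb
    · simp [shiftSet] at hb
    · exact succ_mem_augment.2 (succ_mem_shiftSet.1 hb)
  -- The sender leaves the new name with the visibility of `cur`. The receiver needs only `Γ(a)` and
  -- the new name at `cur`; by transitivity `Γ(a) ⊆ Γ(cur)`, so it can be weakened to all of
  -- `Γ(cur)`.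
  refine ⟨Γ.extend Γ.cur hX, erase_extend _ _ _, ⟨fun hc => ?_, ?_⟩,
    ⟨fun _ => rfl, ?_⟩⟩
  · exact absurd (Option.map_eq_none_iff.1 hc) hv
  · rintro (_ | _ | k) T hT
    · obtain ⟨U, hU, rfl⟩ := Option.map_eq_some_iff.1 hT
      refine ⟨augment Γ.cur S, by simp [val, extend, hS], ?_⟩
      rintro (_ | b) hb
      · exact zero_mem_augment.2 fun Y hY => by rw [hS] at hY; cases hY; rfl
      · exact succ_mem_augment.2 (Γ.trans_cur S hS a ha U hU (succ_mem_addFresh.1 hb))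
    · cases hT
    · exact hvis k T hT
  · rintro (_ | _ | k) T hT
    · cases hT
    · exact ⟨T, hT, fun _ h => h⟩
    · exact hvis k T hT

/-- The visibility of a process after the action `μ`. -/
def next {L : ExprLang.{u}} (Γ : VisFun) : Act L → VisFun
  | .inH a _ => Γ.acquire a
  | .outH _ _ => Γ.release
  | _ => Γ

/-- The actions that a process with visibility `Γ` may perform. -/
def Permits {L : ExprLang.{u}} (Γ : VisFun) : Act L → Prop
  | .tau => Γ.cur ≠ none
  | .inH a _ => Γ.cur = none ∧ Γ.vis a ≠ none
  | .outH a _ => ∃ S, Γ.cur = some S ∧ a ∈ S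
  | .inF _ _ => Γ.cur ≠ none
  | .outF _ _ => Γ.cur = none
  | .succ _ => False

/-- `Γ` does not forbid the action `μ` because of the thread running in parallel to it. -/
def Admits {L : ExprLang.{u}} (Γ : VisFun) : Act L → Prop
  | .inH _ _ => Γ.cur = none
  | .outF _ _ => Γ.cur = none
  | .succ _ => False
  | _ => True

variable {L : ExprLang.{u}}

theorem Admits.passive {Γ : VisFun} {μ : Act L} (h : Γ.Admits μ) : Γ.passive.Admits μ := by
  cases μ <;> simp_all [Admits, VisFun.passive]

/-- Without `cur` only higher-order inputs and first-order outputs are possible, and these are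
admitted only if nobody else holds `cur` either. -/
theorem Permits.passive_eq {Γ : VisFun} {μ : Act L} (h : Γ.passive.Permits μ) (ha : Γ.Admits μ) :
    Γ.passive = Γ := by
  cases μ with
  | tau => exact absurd rfl h
  | inH a v => exact passive_eq_self ha
  | outH a v => obtain ⟨S, hS, -⟩ := h; cases hS
  | inF k v => exact absurd rfl h
  | outF k v => exact passive_eq_self ha
  | succ ω => exact h.elim

end VisFun

/-! ### Subject reduction -/

section Typing

variable {L : ExprLang.{u}}

open Proc VisFun

theorem Typed.act_weaken {Γ : VisFun} {P : Proc L 0} (h : Typed Γ.passive P) (μ : Act L) :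
    Typed (Γ.next μ).passive (μ.weaken P) := by
  cases μ with
  | inH a v => exact h.renH (embeds_succ_of_vis (Γ' := Γ.acquire a) rfl)
  | outH a v => exact h.renH (embeds_succ_of_vis (Γ' := Γ.release) rfl)
  | _ => exact h

theorem Typed.act_res {Γ : VisFun} {P : Proc L 0} (μ : Act L)
    (h : Typed (Γ.next (μ.renH Nat.succ)) P) : Typed (Γ.erase.next μ) (μ.res P) := by
  cases μ with
  | inH a v => exact .resH (h.renH (embeds_permute _ _)) (erase_permute_acquire Γ a)
  | outH a v => exact .resH (h.renH (embeds_permute _ _)) (erase_permute_release Γ)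
  | _ => exact .resH h rfl

theorem VisFun.Permits.erase {Γ : VisFun} {μ : Act L} (h : Γ.Permits (μ.renH Nat.succ)) :
    Γ.erase.Permits μ := by
  cases μ with
  | outH a v =>
    obtain ⟨S, hS, ha⟩ := h
    exact ⟨unshiftSet S, by simp [VisFun.erase, hS], mem_unshiftSet.2 ha⟩
  | _ => simp_all [Permits, VisFun.erase, Act.renH]

theorem VisFun.Admits.of_erase {Γ : VisFun} {μ : Act L} (h : Γ.erase.Admits μ) :
    Γ.Admits (μ.renH Nat.succ) := by
  cases μ <;> simp_all [Admits, VisFun.erase, Act.renH]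

theorem VisFun.admits_renF {Γ : VisFun} {μ : Act L} :
    Γ.Admits (μ.renF Nat.succ) ↔ Γ.Admits μ := by
  cases μ <;> rfl

theorem VisFun.permits_renF {Γ : VisFun} {μ : Act L} :
    Γ.Permits (μ.renF Nat.succ) ↔ Γ.Permits μ := by
  cases μ <;> rfl

theorem VisFun.next_renF {Γ : VisFun} {μ : Act L} : Γ.next (μ.renF Nat.succ) = Γ.next μ := by
  cases μ <;> rfl

theorem Typed.communication {Γ : VisFun} {P' Q' : Proc L 0} {a : ℕ} {v w : L.Val}
    (hP : Γ.passive.Permits (Act.inH a v) ∧ Typed (Γ.passive.next (Act.inH a v)) P')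
    (hQ : Γ.Permits (Act.outH a w) ∧ Typed (Γ.next (Act.outH a w)) Q') :
    Typed Γ (Proc.resH (Proc.par P' Q')) ∧ Typed Γ (Proc.resH (Proc.par Q' P')) := by
  obtain ⟨⟨-, hv⟩, hP'⟩ := hP
  obtain ⟨⟨S, hS, ha⟩, hQ'⟩ := hQ
  obtain ⟨Γ', rfl, h1, h2⟩ := exists_erase_of_mem_cur hS ha hv
  have hP' := Typed.weaken (Γ := Γ'.erase.acquire a) hP' h1
  have hQ' := hQ'.weaken h2
  exact ⟨.resH (.par_left hP' hQ') rfl, .resH (.par_right hQ' hP') rfl⟩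

/-- Subject reduction. -/
theorem Typed.step {P P' : Proc L 0} {μ : Act L} (h : Step P μ P') :
    ∀ {Γ : VisFun}, Typed Γ P → Γ.Admits μ → Γ.Permits μ ∧ Typed (Γ.next μ) P' := by
  induction h with
  | inH a v P =>
    intro Γ hP _
    cases hP with
    | inH hc ha hP => exact ⟨⟨hc, ha⟩, hP.subst _⟩
  | outH a e P =>
    intro Γ hP _
    cases hP with
    | outH hc ha hP => exact ⟨⟨_, hc, ha⟩, hP⟩
  | inF h v P =>
    intro Γ hP _
    cases hP with
    | inF hP hc => exact ⟨hc, hP.subst _⟩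
  | outF h e P =>
    intro Γ hP _
    cases hP with
    | outF hP hc => exact ⟨hc, hP⟩
  -- Success actions must be excluded: `ω.P` is typed by every `Γ`, but its derivative `0` is not
  -- typed when `cur` is defined.
  | succ ω P => exact fun _ h => h.elim
  | repH _ ih =>
    intro Γ hP hμ
    have h := hP
    cases hP with
    | repH hP hc =>
      rw [← passive_eq_self hc] at h
      exact ⟨(ih hP hμ).1, .par_left (ih hP hμ).2 (h.act_weaken _)⟩
  | repF _ ih =>
    intro Γ hP hμ
    have h := hP
    cases hP with
    | repF hP hc =>
      rw [← passive_eq_self hc] at h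
      exact ⟨(ih hP hμ).1, .par_left (ih hP hμ).2 (h.act_weaken _)⟩
  | resH _ ih =>
    intro Γ hP hμ
    cases hP with
    | resH hP he =>
      subst he
      obtain ⟨h1, h2⟩ := ih hP hμ.of_erase
      exact ⟨h1.erase, h2.act_res _⟩
  | resF _ ih =>
    intro Γ hP hμ
    cases hP with
    | resF hP =>
      obtain ⟨h1, h2⟩ := ih hP (admits_renF.2 hμ)
      rw [next_renF] at h2
      exact ⟨permits_renF.1 h1, .resF h2⟩
  | sumL _ ih =>
    intro Γ hP hμ
    cases hP with
    | sum hP hQ => exact ih hP hμ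
  | sumR _ ih =>
    intro Γ hP hμ
    cases hP with
    | sum hP hQ => exact ih hQ hμ
  | parL _ ih =>
    intro Γ hP hμ
    -- If the acting component is the one without `cur`, then `Γ` itself has no `cur`, and the two
    -- forms of the typing coincide.
    have key : Typed Γ _ ∧ Typed Γ.passive _ := hP.par_cases.elim id fun ⟨h1, h2⟩ => by
      have := (ih h1 hμ.passive).1.passive_eq hμ
      rw [this] at h1 ⊢
      exact ⟨h1, h2⟩
    exact ⟨(ih key.1 hμ).1, .par_left (ih key.1 hμ).2 (key.2.act_weaken _)⟩
  | parR _ ih =>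
    intro Γ hP hμ
    have key : Typed Γ.passive _ ∧ Typed Γ _ := hP.par_cases.symm.elim id fun ⟨h1, h2⟩ => by
      have := (ih h2 hμ.passive).1.passive_eq hμ
      rw [this] at h2 ⊢
      exact ⟨h1, h2⟩
    exact ⟨(ih key.2 hμ).1, .par_right (key.1.act_weaken _) (ih key.2 hμ).2⟩
  | comHL _ _ ihP ihQ =>
    intro Γ hP _
    -- A higher-order output needs `cur`, so the sender must hold it; the other distribution is
    -- contradictory.
    rcases hP.par_cases with ⟨h1, h2⟩ | ⟨h1, h2⟩
    · obtain ⟨⟨S, hS, -⟩, -⟩ := ihQ h2 trivial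
      cases hS
    · have hQ := ihQ h2 trivial
      obtain ⟨S, hS, ha⟩ := hQ.1
      exact ⟨by simp [Permits, hS], (Typed.communication (ihP h1 rfl) hQ).1⟩
  | comHR _ _ ihP ihQ =>
    intro Γ hP _
    rcases hP.par_cases with ⟨h1, h2⟩ | ⟨h1, h2⟩
    · have hP := ihP h1 trivial
      obtain ⟨S, hS, ha⟩ := hP.1
      exact ⟨by simp [Permits, hS], (Typed.communication (ihQ h2 rfl) hP).2⟩
    · obtain ⟨⟨S, hS, -⟩, -⟩ := ihP h1 trivial
      cases hS
  | comFL _ _ ihP ihQ =>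
    intro Γ hP _
    rcases hP.par_cases with ⟨h1, h2⟩ | ⟨h1, h2⟩
    · exact ⟨(ihP h1 trivial).1, .par_left (ihP h1 trivial).2 (ihQ h2 rfl).2⟩
    · exact absurd rfl (ihP h1 trivial).1
  | comFR _ _ ihP ihQ =>
    intro Γ hP _
    rcases hP.par_cases with ⟨h1, h2⟩ | ⟨h1, h2⟩
    · exact absurd rfl (ihQ h2 trivial).1
    · exact ⟨(ihQ h2 trivial).1, .par_right (ihP h1 rfl).2 (ihQ h2 trivial).2⟩
  | condT _ _ ih =>
    intro Γ hP hμ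
    cases hP with
    | cond hP hQ => exact ih hP hμ
  | condF _ _ ih =>
    intro Γ hP hμ
    cases hP with
    | cond hP hQ => exact ih hQ hμ

end Typing

end VPi

namespace VPi

universe u

variable {L : ExprLang.{u}}

open Proc VisFun

/-! ### Success names and their preservation by transitions -/

/-- All success names that occur in the process are in `S`. -/
def Proc.SuccIn (S : Set ℕ) : {n : ℕ} → Proc L n → Prop
  | _, nil => True
  | _, inH _ P => SuccIn S P
  | _, inF _ P => SuccIn S P
  | _, outH _ _ P => SuccIn S P
  | _, outF _ _ P => SuccIn S P
  | _, succ ω P => ω ∈ S ∧ SuccIn S P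
  | _, repH _ P => SuccIn S P
  | _, repF _ P => SuccIn S P
  | _, par P Q => SuccIn S P ∧ SuccIn S Q
  | _, sum P Q => SuccIn S P ∧ SuccIn S Q
  | _, resH P => SuccIn S P
  | _, resF P => SuccIn S P
  | _, cond _ _ P Q => SuccIn S P ∧ SuccIn S Q

namespace Proc.SuccIn

theorem of_successFree {n : ℕ} {P : Proc L n} (h : P.SuccessFree) : P.SuccIn ∅ := by
  induction P <;> simp_all [SuccessFree, SuccIn]

theorem mono {S T : Set ℕ} (hST : S ⊆ T) {n : ℕ} {P : Proc L n} (h : P.SuccIn S) :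
    P.SuccIn T := by
  induction P with
  | succ ω P ih => exact ⟨hST h.1, ih h.2⟩
  | _ => simp_all [SuccIn]

theorem exists_lt {n : ℕ} (P : Proc L n) : ∃ N : ℕ, P.SuccIn (Set.Iio N) := by
  have two : ∀ {n : ℕ} {P Q : Proc L n}, (∃ N : ℕ, P.SuccIn (Set.Iio N)) →
      (∃ N : ℕ, Q.SuccIn (Set.Iio N)) →
      ∃ N : ℕ, P.SuccIn (Set.Iio N) ∧ Q.SuccIn (Set.Iio N) := by
    rintro n P Q ⟨N, hN⟩ ⟨M, hM⟩
    exact ⟨max N M, hN.mono (Set.Iio_subset_Iio (le_max_left _ _)),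
      hM.mono (Set.Iio_subset_Iio (le_max_right _ _))⟩
  induction P with
  | nil => exact ⟨0, trivial⟩
  | succ ω P ih =>
    obtain ⟨N, hN⟩ := ih
    exact ⟨max N (ω + 1), by simp, hN.mono (Set.Iio_subset_Iio (le_max_left _ _))⟩
  | par P Q ihP ihQ => exact two ihP ihQ
  | sum P Q ihP ihQ => exact two ihP ihQ
  | cond e f P Q ihP ihQ => exact two ihP ihQ
  | inH a P ih => exact ih
  | inF a P ih => exact ih
  | outH a e P ih => exact ih
  | outF a e P ih => exact ih
  | repH a P ih => exact ih
  | repF a P ih => exact ih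
  | resH P ih => exact ih
  | resF P ih => exact ih

theorem subst {S : Set ℕ} {n : ℕ} {P : Proc L n} (h : P.SuccIn S) :
    ∀ {m : ℕ} (σ : Fin n → Expr L m), (P.subst σ).SuccIn S := by
  induction P with
  | succ ω P ih => exact fun σ => ⟨h.1, ih h.2 σ⟩
  | par P Q ihP ihQ => exact fun σ => ⟨ihP h.1 σ, ihQ h.2 σ⟩
  | sum P Q ihP ihQ => exact fun σ => ⟨ihP h.1 σ, ihQ h.2 σ⟩
  | cond e f P Q ihP ihQ => exact fun σ => ⟨ihP h.1 σ, ihQ h.2 σ⟩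
  | _ => simp_all [SuccIn, Proc.subst]

theorem renH {S : Set ℕ} {n : ℕ} {P : Proc L n} (h : P.SuccIn S) :
    ∀ f : ℕ → ℕ, (P.renH f).SuccIn S := by
  induction P <;> simp_all [SuccIn, Proc.renH]

theorem act_weaken {S : Set ℕ} {P : Proc L 0} (h : P.SuccIn S) (μ : Act L) :
    (μ.weaken P).SuccIn S := by
  cases μ <;> first | exact h.renH _ | exact h

theorem act_res {S : Set ℕ} {P : Proc L 0} (h : P.SuccIn S) (μ : Act L) :
    (μ.res P).SuccIn S := by
  cases μ <;> first | exact h.renH _ | exact h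

theorem step {S : Set ℕ} {P P' : Proc L 0} {μ : Act L} (hs : Step P μ P') :
    P.SuccIn S → P'.SuccIn S := by
  induction hs with
  | inH a v P => exact fun h => SuccIn.subst (P := P) h _
  | inF a v P => exact fun h => SuccIn.subst (P := P) h _
  | outH a e P => exact id
  | outF a e P => exact id
  | succ ω P => exact fun _ => trivial
  | repH _ ih => exact fun h => ⟨ih h, act_weaken h _⟩
  | repF _ ih => exact fun h => ⟨ih h, act_weaken h _⟩
  | resH _ ih => exact fun h => act_res (ih h) _
  | resF _ ih => exact ih
  | sumL _ ih => exact fun h => ih h.1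
  | sumR _ ih => exact fun h => ih h.2
  | parL _ ih => exact fun h => ⟨ih h.1, act_weaken h.2 _⟩
  | parR _ ih => exact fun h => ⟨act_weaken h.1 _, ih h.2⟩
  | comHL _ _ ihP ihQ => exact fun h => ⟨ihP h.1, ihQ h.2⟩
  | comHR _ _ ihP ihQ => exact fun h => ⟨ihP h.1, ihQ h.2⟩
  | comFL _ _ ihP ihQ => exact fun h => ⟨ihP h.1, ihQ h.2⟩
  | comFR _ _ ihP ihQ => exact fun h => ⟨ihP h.1, ihQ h.2⟩
  | condT _ _ ih => exact fun h => ih h.1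
  | condF _ _ ih => exact fun h => ih h.2

theorem mem_of_step {S : Set ℕ} {ω : ℕ} {P P' : Proc L 0} {μ : Act L} (hs : Step P μ P') :
    μ = .succ ω → P.SuccIn S → ω ∈ S := by
  induction hs with
  | succ ω P => rintro ⟨⟩ h; exact h.1
  | repH _ ih => exact fun he h => ih he h
  | repF _ ih => exact fun he h => ih he h
  | resH _ ih => rintro rfl h; exact ih rfl h
  | resF _ ih => rintro rfl h; exact ih rfl h
  | sumL _ ih => exact fun he h => ih he h.1
  | sumR _ ih => exact fun he h => ih he h.2
  | parL _ ih => exact fun he h => ih he h.1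
  | parR _ ih => exact fun he h => ih he h.2
  | condT _ _ ih => exact fun he h => ih he h.1
  | condF _ _ ih => exact fun he h => ih he h.2
  | _ => intro he; cases he

theorem reds {S : Set ℕ} {P P' : Proc L 0} (h : Reds P P') (hP : P.SuccIn S) : P'.SuccIn S := by
  induction h with
  | refl => exact hP
  | tail _ hr ih => exact ih.step hr

theorem mem_of_weakBarb {S : Set ℕ} {P : Proc L 0} {ω : ℕ} (hP : P.SuccIn S)
    (h : WeakBarb P ω) : ω ∈ S := by
  obtain ⟨P', hr, P'', hs⟩ := h
  exact mem_of_step hs rfl (hP.reds hr)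

end Proc.SuccIn

/-! ### Interaction of a process with an observer -/

/-- The action is a communication with the environment. -/
def Act.Visible : Act L → Prop
  | tau => False
  | succ _ => False
  | _ => True

/-- The action of the partner in a communication. -/
def Act.dual : Act L → Act L
  | inH a v => outH a v
  | outH a v => inH a v
  | inF h v => outF h v
  | outF h v => inF h v
  | μ => μ

/-- The restriction of the name transmitted in `μ`, if any. -/
def Act.scope : Act L → Proc L 0 → Proc L 0
  | inH _ _, X => Proc.resH X
  | outH _ _, X => Proc.resH X
  | _, X => X

/-- The result of a communication in which the left process performs `μ`. -/
def Act.link (μ : Act L) (P Q : Proc L 0) : Proc L 0 := μ.scope (Proc.par P Q)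

/-- Reductions of `P | R` in which `R` takes part. -/
inductive Interact (P R : Proc L 0) : Proc L 0 → Prop
  | tau {R' : Proc L 0} : Red R R' → Interact P R (par P R')
  | com {P' R' : Proc L 0} {μ : Act L} : μ.Visible → Step P μ P' → Step R μ.dual R' →
      Interact P R (μ.link P' R')

theorem Interact.red {P R X : Proc L 0} (h : Interact P R X) : Red (par P R) X := by
  cases h with
  | tau h => exact Step.parR (μ := .tau) h
  | com hμ hP hR =>
    rename_i μ
    cases μ with
    | inH a v => exact .comHL hP hR
    | outH a v => exact .comHR hP hR
    | inF a v => exact .comFL hP hR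
    | outF a v => exact .comFR hP hR
    | tau => exact hμ.elim
    | succ ω => exact hμ.elim

theorem Red.par_left {P P' : Proc L 0} (h : Red P P') (R : Proc L 0) :
    Red (par P R) (par P' R) := Step.parL (μ := .tau) h

theorem Red.par_cases {P R X : Proc L 0} (h : Red (par P R) X) :
    (∃ P', Red P P' ∧ X = par P' R) ∨ Interact P R X := by
  cases h with
  | parL h => exact .inl ⟨_, h, rfl⟩
  | parR h => exact .inr (.tau h)
  | comHL h1 h2 => exact .inr (.com (μ := .inH _ _) trivial h1 h2)
  | comHR h1 h2 => exact .inr (.com (μ := .outH _ _) trivial h1 h2)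
  | comFL h1 h2 => exact .inr (.com (μ := .inF _ _) trivial h1 h2)
  | comFR h1 h2 => exact .inr (.com (μ := .outF _ _) trivial h1 h2)

theorem Red.resH {P P' : Proc L 0} (h : Red P P') : Red (Proc.resH P) (Proc.resH P') :=
  Step.resH (μ := .tau) h

theorem Red.resH_cases {P X : Proc L 0} (h : Red (Proc.resH P) X) :
    ∃ P', Red P P' ∧ X = Proc.resH P' := by
  cases h with
  | resH h => exact ⟨_, h, rfl⟩

theorem Reds.par_left {P P' : Proc L 0} (h : Reds P P') (R : Proc L 0) :
    Reds (par P R) (par P' R) := h.lift (fun P => par P R) fun _ _ h => h.par_left R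

theorem Reds.resH {P P' : Proc L 0} (h : Reds P P') : Reds (Proc.resH P) (Proc.resH P') :=
  h.lift Proc.resH fun _ _ h => h.resH

theorem Reds.resH_cases {P X : Proc L 0} (h : Reds (Proc.resH P) X) :
    ∃ P', Reds P P' ∧ X = Proc.resH P' := by
  induction h with
  | refl => exact ⟨P, .refl, rfl⟩
  | tail _ hr ih =>
    obtain ⟨P', h, rfl⟩ := ih
    obtain ⟨P'', h', rfl⟩ := hr.resH_cases
    exact ⟨P'', h.tail h', rfl⟩

/-- Cutting the sequence at the first step in which `R` takes part; this is how commitments of an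
observer are located in the completeness proof. -/
theorem Reds.par_cases {P R X : Proc L 0} (h : Reds (par P R) X) :
    (∃ P', Reds P P' ∧ X = par P' R) ∨
      ∃ P' Z, Reds P P' ∧ Interact P' R Z ∧ Reds Z X := by
  induction h with
  | refl => exact .inl ⟨P, .refl, rfl⟩
  | tail _ hr ih =>
    rcases ih with ⟨P', h, rfl⟩ | ⟨P', Z, h, hi, hz⟩
    · rcases hr.par_cases with ⟨P'', h', rfl⟩ | hi
      · exact .inl ⟨P'', h.tail h', rfl⟩
      · exact .inr ⟨P', _, h, hi, .refl⟩
    · exact .inr ⟨P', Z, h, hi, hz.tail hr⟩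

theorem VReds.reds {Γ : VisFun} {P P' : Proc L 0} (h : VReds Γ P P') : Reds P P' :=
  h.lift id fun _ _ h => by cases h with | tau h _ => exact h

theorem Reds.vReds {Γ : VisFun} (hΓ : Γ.cur = none) {P P' : Proc L 0} (h : Reds P P') :
    VReds Γ P P' := h.lift id fun _ _ h => .tau h hΓ

theorem VStep.step {Γ Γ' : VisFun} {P P' : Proc L 0} {μ : Act L} (h : VStep Γ P μ Γ' P') :
    Step P μ P' := by
  cases h <;> assumption

theorem Reds.link {P P' : Proc L 0} (h : Reds P P') (μ : Act L) (R : Proc L 0) :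
    Reds (μ.link P R) (μ.link P' R) := by
  cases μ <;> first | exact (h.par_left R).resH | exact h.par_left R

theorem WeakVStep.reds_link {Γ Γ' : VisFun} {P P' R R' : Proc L 0} {μ : Act L}
    (h : WeakVStep Γ P μ Γ' P') (hμ : μ.Visible) (hR : Step R μ.dual R') :
    Reds (par P R) (μ.link P' R') := by
  cases h with
  | tau _ => exact hμ.elim
  | act _ h1 h2 h3 =>
    exact ((h1.reds.par_left R).tail (Interact.com hμ h2.step hR).red).trans (h3.reds.link μ R')

/-! ### Soundness -/

/-- `P` is typed by a visibility function compatible with `Γ`. -/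
def CoTyped (Γ : VisFun) (P : Proc L 0) : Prop := ∃ Δ : VisFun, Compatible Δ Γ ∧ Typed Δ P

theorem CoTyped.vStep {Γ Γ' : VisFun} {P P' : Proc L 0} {μ : Act L} (hP : CoTyped Γ P)
    (h : VStep Γ P μ Γ' P') : CoTyped Γ' P' := by
  obtain ⟨Δ, hc, hP⟩ := hP
  cases h with
  | outH h _ _ => exact ⟨_, .inl rfl, (hP.step h trivial).2⟩
  | inH h hS _ => exact ⟨_, .inr rfl, (hP.step h (hc.resolve_right (by simp [hS]))).2⟩
  | outF h hΓ => exact ⟨Δ, hc, (hP.step h (hc.resolve_right hΓ)).2⟩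
  | inF h hΓ => exact ⟨Δ, hc, (hP.step h trivial).2⟩
  | tau h hΓ => exact ⟨Δ, hc, (hP.step h trivial).2⟩

/-- A process that reduces holds `cur`, so a compatible observer does not. Hence type-allowed and
plain reductions agree on co-typed processes. -/
theorem CoTyped.cur_eq_none {Γ : VisFun} {P P' : Proc L 0} (hP : CoTyped Γ P) (h : Red P P') :
    Γ.cur = none := by
  obtain ⟨Δ, hc, hP⟩ := hP
  exact hc.resolve_left (hP.step h trivial).1

theorem CoTyped.vReds {Γ : VisFun} {P P' : Proc L 0} (hP : CoTyped Γ P) (h : VReds Γ P P') :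
    CoTyped Γ P' := by
  induction h with
  | refl => exact hP
  | tail _ h ih => exact ih.vStep h

theorem CoTyped.vReds_of_reds {Γ : VisFun} {P P' : Proc L 0} (hP : CoTyped Γ P)
    (h : Reds P P') : VReds Γ P P' := by
  induction h with
  | refl => exact .refl
  | tail _ h ih => exact ih.tail (.tau h ((hP.vReds ih).cur_eq_none h))

theorem CoTyped.weakVStep {Γ Γ' : VisFun} {P P' : Proc L 0} {μ : Act L} (hP : CoTyped Γ P)
    (h : WeakVStep Γ P μ Γ' P') : CoTyped Γ' P' := by
  cases h with
  | tau h => exact hP.vReds h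
  | act _ h1 h2 h3 => exact ((hP.vReds h1).vStep h2).vReds h3

/-- Communications between a process and an observer of visibility `Γ` are type-allowed. -/
theorem CoTyped.exists_vStep {Γ : VisFun} {P P' R R' : Proc L 0} {μ : Act L} (hP : CoTyped Γ P)
    (hR : Typed Γ R) (hμ : μ.Visible) (h1 : Step P μ P') (h2 : Step R μ.dual R') :
    ∃ Γ', VStep Γ P μ Γ' P' ∧ Typed Γ' R' := by
  obtain ⟨Δ, hc, hP⟩ := hP
  cases μ with
  | inH a v =>
    obtain ⟨⟨S, hS, ha⟩, hR'⟩ := hR.step h2 trivial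
    exact ⟨_, .inH h1 hS ha, hR'⟩
  | outH a v =>
    obtain ⟨⟨S, hS, -⟩, -⟩ := hP.step h1 trivial
    have hΓ : Γ.cur = none := hc.resolve_left (by simp [hS])
    obtain ⟨⟨-, ha⟩, hR'⟩ := hR.step h2 hΓ
    exact ⟨_, .outH h1 ha hΓ, hR'⟩
  | inF k v =>
    have hΓ : Γ.cur = none := hc.resolve_left (hP.step h1 trivial).1
    exact ⟨Γ, .inF h1 hΓ, (hR.step h2 hΓ).2⟩
  | outF k v =>
    obtain ⟨hΓ, hR'⟩ := hR.step h2 trivial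
    exact ⟨Γ, .outF h1 hΓ, hR'⟩
  | tau => exact hμ.elim
  | succ ω => exact hμ.elim

theorem TypedBisimilar.symm {Γ : VisFun} {P Q : Proc L 0} (h : TypedBisimilar Γ P Q) :
    TypedBisimilar Γ Q P := by
  obtain ⟨R, hR, h⟩ := h
  exact ⟨fun Γ P Q => R Γ Q P, ⟨fun Γ P Q h => hR.right Γ Q P h, fun Γ P Q h => hR.left Γ Q P h⟩, h⟩

theorem TypedBisimilar.vStep {Γ Γ' : VisFun} {P P' Q : Proc L 0} {μ : Act L}
    (h : TypedBisimilar Γ P Q) (hs : VStep Γ P μ Γ' P') :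
    ∃ Q', WeakVStep Γ Q μ Γ' Q' ∧ TypedBisimilar Γ' P' Q' := by
  obtain ⟨R, hR, h⟩ := h
  obtain ⟨Q', h1, h2⟩ := hR.left Γ P Q h μ Γ' P' hs
  exact ⟨Q', h1, R, hR, h2⟩

/-- Barbed bisimulations that take into account only the success names in `O`. -/
structure IsBarbedBisimulationOn (O : Set ℕ) (R : Proc L 0 → Proc L 0 → Prop) : Prop where
  symm : ∀ P Q, R P Q → R Q P
  red : ∀ P Q, R P Q → ∀ P', Red P P' → ∃ Q', Reds Q Q' ∧ R P' Q'
  barb : ∀ P Q, R P Q → ∀ ω ∈ O, WeakBarb P ω → WeakBarb Q ω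

theorem IsBarbedBisimulationOn.of_step {O : Set ℕ} {R : Proc L 0 → Proc L 0 → Prop}
    (symm : ∀ P Q, R P Q → R Q P)
    (red : ∀ P Q, R P Q → ∀ P', Red P P' → ∃ Q', Reds Q Q' ∧ R P' Q')
    (barb : ∀ P Q, R P Q → ∀ ω ∈ O, ∀ P', Step P (.succ ω) P' → WeakBarb Q ω) :
    IsBarbedBisimulationOn O R where
  symm := symm
  red := red
  barb := by
    rintro P Q h ω hω ⟨P', hr, P'', hs⟩
    have : ∃ Q', Reds Q Q' ∧ R P' Q' := by
      clear hs
      induction hr with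
      | refl => exact ⟨Q, .refl, h⟩
      | tail _ hr ih =>
        obtain ⟨Q', h1, h2⟩ := ih
        obtain ⟨Q'', h3, h4⟩ := red _ _ h2 _ hr
        exact ⟨Q'', h1.trans h3, h4⟩
    obtain ⟨Q', h1, h2⟩ := this
    obtain ⟨Q'', h3, h4⟩ := barb _ _ h2 ω hω _ hs
    exact ⟨Q'', h1.trans h3, h4⟩

/-- The pairs `(ν a₁) ⋯ (ν aₖ) (P | R)` and `(ν a₁) ⋯ (ν aₖ) (Q | R)` for bisimilar `P`, `Q`. -/
inductive BisimContext : Proc L 0 → Proc L 0 → Prop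
  | base {Γ : VisFun} {P Q R : Proc L 0} : TypedBisimilar Γ P Q → CoTyped Γ P → CoTyped Γ Q →
      P.SuccIn ∅ → Q.SuccIn ∅ → Typed Γ R → BisimContext (par P R) (par Q R)
  | res {X Y : Proc L 0} : BisimContext X Y → BisimContext (resH X) (resH Y)

theorem WeakVStep.succIn {Γ Γ' : VisFun} {P P' : Proc L 0} {μ : Act L}
    (h : WeakVStep Γ P μ Γ' P') {S : Set ℕ} (hP : P.SuccIn S) : P'.SuccIn S := by
  cases h with
  | tau h => exact hP.reds h.reds
  | act _ h1 h2 h3 => exact ((hP.reds h1.reds).step h2.step).reds h3.reds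

theorem BisimContext.link {Γ : VisFun} {P Q R : Proc L 0} (μ : Act L) (h : TypedBisimilar Γ P Q)
    (hP : CoTyped Γ P) (hQ : CoTyped Γ Q) (sP : P.SuccIn ∅) (sQ : Q.SuccIn ∅) (hR : Typed Γ R) :
    BisimContext (μ.link P R) (μ.link Q R) := by
  have hb := BisimContext.base h hP hQ sP sQ hR
  cases μ <;> first | exact .res hb | exact hb

theorem BisimContext.symm {X Y : Proc L 0} (h : BisimContext X Y) : BisimContext Y X := by
  induction h with
  | base h hP hQ sP sQ hR => exact .base h.symm hQ hP sQ sP hR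
  | res _ ih => exact .res ih

/-- Each reduction of `P | R` is a step of `P`, a step of `R`, or a communication; the first and
last are type-allowed transitions of `P`, which bisimilarity matches under the same new visibility
of the observer. -/
theorem BisimContext.red {X Y : Proc L 0} (h : BisimContext X Y) :
    ∀ X', Red X X' → ∃ Y', Reds Y Y' ∧ BisimContext X' Y' := by
  induction h with
  | @base Γ P Q R h hP hQ sP sQ hR =>
    intro X' hr
    rcases hr.par_cases with ⟨P', hP', rfl⟩ | hi
    · have hs : VStep Γ P .tau Γ P' := .tau hP' (hP.cur_eq_none hP')
      obtain ⟨Q', hw, hb⟩ := h.vStep hs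
      refine ⟨par Q' R, ?_, .base hb (hP.vStep hs) (hQ.weakVStep hw) (sP.step hP')
        (hw.succIn sQ) hR⟩
      cases hw with
      | tau hw => exact hw.reds.par_left R
      | act h0 => exact absurd rfl h0
    · cases hi with
      | @tau R' hR' =>
        exact ⟨par Q R', .single (Interact.tau hR').red, .base h hP hQ sP sQ (hR.step hR' trivial).2⟩
      | @com P' R' μ hμ h1 h2 =>
        obtain ⟨Γ', hs, hR'⟩ := hP.exists_vStep hR hμ h1 h2
        obtain ⟨Q', hw, hb⟩ := h.vStep hs
        exact ⟨μ.link Q' R', hw.reds_link hμ h2, .link μ hb (hP.vStep hs) (hQ.weakVStep hw)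
          (sP.step h1) (hw.succIn sQ) hR'⟩
  | res _ ih =>
    intro X' hr
    obtain ⟨X'', hX, rfl⟩ := hr.resH_cases
    obtain ⟨Y', h1, h2⟩ := ih _ hX
    exact ⟨_, h1.resH, .res h2⟩

theorem BisimContext.succ {X Y : Proc L 0} (h : BisimContext X Y) {ω : ℕ} :
    ∀ {X'}, Step X (.succ ω) X' → ∃ Y', Step Y (.succ ω) Y' := by
  induction h with
  | base h hP hQ sP sQ hR =>
    intro X' hs
    cases hs with
    | parL hs => exact (SuccIn.mem_of_step hs rfl sP).elim
    | parR hs => exact ⟨_, .parR hs⟩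
  | res _ ih =>
    intro X' hs
    cases hs with
    | resH hs =>
      obtain ⟨Y', h⟩ := ih hs
      exact ⟨_, .resH (μ := .succ ω) h⟩

theorem soundness {Γ : VisFun} {P Q R : Proc L 0} (h : TypedBisimilar Γ P Q)
    (hP : CoTyped Γ P) (hQ : CoTyped Γ Q) (sP : P.SuccIn ∅) (sQ : Q.SuccIn ∅) (hR : Typed Γ R) :
    BarbedBisimilar (par P R) (par Q R) := by
  have hB : IsBarbedBisimulationOn Set.univ (BisimContext (L := L)) :=
    .of_step (fun _ _ h => h.symm) (fun _ _ h => h.red) fun _ Y h ω _ _ hs => by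
      obtain ⟨Y', hs⟩ := h.succ hs
      exact ⟨Y, .refl, Y', hs⟩
  exact ⟨BisimContext, ⟨hB.symm, hB.red, fun P Q h ω => hB.barb P Q h ω trivial⟩,
    .base h hP hQ sP sQ hR⟩

end VPi

namespace VPi

universe u

variable {L : ExprLang.{u}}

open Proc VisFun

/-! ### Composition of first-order substitutions -/

theorem Expr.subst_subst {n m k : ℕ} (σ : Fin n → Expr L m) (τ : Fin m → Expr L k) (e : Expr L n) :
    (e.subst σ).subst τ = e.subst fun i => (σ i).subst τ := by
  induction e <;> simp_all [Expr.subst]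

theorem Expr.subst_var {n : ℕ} (e : Expr L n) : e.subst Expr.var = e := by
  induction e <;> simp_all [Expr.subst]

theorem Expr.lift_subst {n m k : ℕ} (σ : Fin n → Expr L m) (τ : Fin m → Expr L k) :
    (fun i => (Expr.lift σ i).subst (Expr.lift τ)) = Expr.lift fun i => (σ i).subst τ := by
  funext i
  refine Fin.cases rfl (fun i => ?_) i
  simp [Expr.lift, Expr.subst_subst, Expr.subst]

theorem Expr.lift_var {n : ℕ} : Expr.lift (Expr.var : Fin n → Expr L n) = Expr.var := by
  funext i
  exact Fin.cases rfl (fun i => rfl) i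

theorem Proc.subst_subst {n : ℕ} (P : Proc L n) : ∀ {m k : ℕ} (σ : Fin n → Expr L m)
    (τ : Fin m → Expr L k), (P.subst σ).subst τ = P.subst fun i => (σ i).subst τ := by
  induction P <;> simp_all [Proc.subst, Expr.subst_subst, Expr.lift_subst]

theorem Proc.subst_var {n : ℕ} (P : Proc L n) : P.subst Expr.var = P := by
  induction P <;> simp_all [Proc.subst, Expr.subst_var, Expr.lift_var]

theorem Proc.subst_eq_self (P : Proc L 0) (σ : Fin 0 → Expr L 0) : P.subst σ = P := by
  rw [Subsingleton.elim σ Expr.var, P.subst_var]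

/-! ### Barbed bisimilarity on selected success names -/

/-- Barbed bisimilarity with respect to the success names in `O`. -/
def BarbedBisimilarOn (O : Set ℕ) (P Q : Proc L 0) : Prop :=
  ∃ R : Proc L 0 → Proc L 0 → Prop, IsBarbedBisimulationOn O R ∧ R P Q

theorem BarbedBisimilar.on {P Q : Proc L 0} (h : BarbedBisimilar P Q) (O : Set ℕ) :
    BarbedBisimilarOn O P Q := by
  obtain ⟨R, hR, h⟩ := h
  exact ⟨R, ⟨hR.symm, hR.red, fun P Q h ω _ => hR.barb P Q h ω⟩, h⟩

namespace BarbedBisimilarOn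

variable {O : Set ℕ} {P Q : Proc L 0}

theorem symm (h : BarbedBisimilarOn O P Q) : BarbedBisimilarOn O Q P := by
  obtain ⟨R, hR, h⟩ := h
  exact ⟨R, hR, hR.symm _ _ h⟩

theorem red (h : BarbedBisimilarOn O P Q) {P' : Proc L 0} (hr : Red P P') :
    ∃ Q', Reds Q Q' ∧ BarbedBisimilarOn O P' Q' := by
  obtain ⟨R, hR, h⟩ := h
  obtain ⟨Q', h1, h2⟩ := hR.red _ _ h _ hr
  exact ⟨Q', h1, R, hR, h2⟩

theorem barb_iff (h : BarbedBisimilarOn O P Q) {ω : ℕ} (hω : ω ∈ O) :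
    WeakBarb P ω ↔ WeakBarb Q ω := by
  obtain ⟨R, hR, h⟩ := h
  exact ⟨hR.barb _ _ h ω hω, hR.barb _ _ (hR.symm _ _ h) ω hω⟩

end BarbedBisimilarOn

theorem WeakBarb.of_reds {P Q : Proc L 0} {ω : ℕ} (h : Reds P Q) (hQ : WeakBarb Q ω) :
    WeakBarb P ω := by
  obtain ⟨Q', h1, h2⟩ := hQ
  exact ⟨Q', h.trans h1, h2⟩

theorem weakBarb_resH {X : Proc L 0} {ω : ℕ} : WeakBarb (resH X) ω ↔ WeakBarb X ω := by
  constructor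
  · rintro ⟨Y, hr, Z, hs⟩
    obtain ⟨Y, hY, rfl⟩ := hr.resH_cases
    cases hs with
    | resH hs => exact ⟨Y, hY, _, hs⟩
  · rintro ⟨Y, hr, Z, hs⟩
    exact ⟨_, hr.resH, _, .resH (μ := .succ ω) hs⟩

/-- Reductions and barbs of a process are exactly those of its restriction, so restrictions left by
a communication can be discarded. -/
theorem BarbedBisimilarOn.of_resH {O : Set ℕ} {X Y : Proc L 0}
    (h : BarbedBisimilarOn O (resH X) (resH Y)) : BarbedBisimilarOn O X Y := by
  refine ⟨fun X Y => BarbedBisimilarOn O (resH X) (resH Y), ⟨fun _ _ h => h.symm, ?_, ?_⟩, h⟩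
  · intro X Y h X' hr
    obtain ⟨Y', h1, h2⟩ := h.red hr.resH
    obtain ⟨Y', h3, rfl⟩ := h1.resH_cases
    exact ⟨Y', h3, h2⟩
  · intro X Y h ω hω hX
    exact weakBarb_resH.1 ((h.barb_iff hω).1 (weakBarb_resH.2 hX))

theorem weakBarb_scope {μ : Act L} {X : Proc L 0} {ω : ℕ} :
    WeakBarb (μ.scope X) ω ↔ WeakBarb X ω := by
  cases μ <;> first | exact weakBarb_resH | exact Iff.rfl

theorem BarbedBisimilarOn.of_scope {O : Set ℕ} {μ : Act L} {X Y : Proc L 0}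
    (h : BarbedBisimilarOn O (μ.scope X) (μ.scope Y)) : BarbedBisimilarOn O X Y := by
  cases μ <;> first | exact h.of_resH | exact h

theorem Reds.scope_cases {μ : Act L} {X Y : Proc L 0} (h : Reds (μ.scope X) Y) :
    ∃ X', Reds X X' ∧ Y = μ.scope X' := by
  cases μ <;> first | exact h.resH_cases | exact ⟨Y, h, rfl⟩

/-! ### Flags: success signals in parallel to an observer -/

/-- The process `R | ω. 0`. -/
def flagged (ω : ℕ) (R : Proc L 0) : Proc L 0 := par R (succ ω nil)

/-- `Flag ω X Y`: the process `Y` is `X` with `ω. 0` put in parallel to a component of it. -/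
inductive Flag (ω : ℕ) : Proc L 0 → Proc L 0 → Prop
  | base (R : Proc L 0) : Flag ω R (flagged ω R)
  | par (A : Proc L 0) {X Y : Proc L 0} : Flag ω X Y → Flag ω (par A X) (par A Y)
  | res {X Y : Proc L 0} : Flag ω X Y → Flag ω (resH X) (resH Y)

namespace Flag

variable {ω : ℕ} {X Y : Proc L 0}

theorem renH (h : Flag ω X Y) : ∀ f : ℕ → ℕ, Flag ω (X.renH f) (Y.renH f) := by
  induction h with
  | base R => exact fun f => .base _
  | par A _ ih => exact fun f => .par _ (ih f)
  | res _ ih => exact fun f => .res (ih _)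

theorem act_weaken (h : Flag ω X Y) (μ : Act L) : Flag ω (μ.weaken X) (μ.weaken Y) := by
  cases μ <;> first | exact h.renH _ | exact h

theorem act_res (h : Flag ω X Y) (μ : Act L) : Flag ω (μ.res X) (μ.res Y) := by
  cases μ <;> first | exact .res (h.renH _) | exact .res h

theorem act_scope (h : Flag ω X Y) (μ : Act L) : Flag ω (μ.scope X) (μ.scope Y) := by
  cases μ <;> first | exact .res h | exact h

theorem act_weaken_succ (μ : Act L) : μ.weaken (succ ω nil) = succ ω nil := by
  cases μ <;> rfl

theorem step (h : Flag ω X Y) : ∀ {μ : Act L} {X'}, Step X μ X' → ∃ Y', Step Y μ Y' ∧ Flag ω X' Y' := by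
  induction h with
  | base R =>
    intro μ X' hs
    refine ⟨flagged ω X', ?_, .base _⟩
    have := Step.parL (Q := succ ω nil) hs
    rwa [act_weaken_succ] at this
  | par A h ih =>
    intro μ X' hs
    cases hs with
    | parL hs => exact ⟨_, .parL hs, .par _ (h.act_weaken _)⟩
    | parR hs =>
      obtain ⟨Y', h1, h2⟩ := ih hs
      exact ⟨_, .parR h1, .par _ h2⟩
    | comHL hA hs =>
      obtain ⟨Y', h1, h2⟩ := ih hs
      exact ⟨_, .comHL hA h1, .res (.par _ h2)⟩
    | comHR hA hs =>
      obtain ⟨Y', h1, h2⟩ := ih hs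
      exact ⟨_, .comHR hA h1, .res (.par _ h2)⟩
    | comFL hA hs =>
      obtain ⟨Y', h1, h2⟩ := ih hs
      exact ⟨_, .comFL hA h1, .par _ h2⟩
    | comFR hA hs =>
      obtain ⟨Y', h1, h2⟩ := ih hs
      exact ⟨_, .comFR hA h1, .par _ h2⟩
  | res _ ih =>
    intro μ X' hs
    cases hs with
    | resH hs =>
      obtain ⟨Y', h1, h2⟩ := ih hs
      exact ⟨_, .resH h1, h2.act_res _⟩

/-- A success action has no communication partner, so the flag never influences reductions and never
disappears in them. -/
theorem step_inv (h : Flag ω X Y) : ∀ {μ : Act L} {Y'}, Step Y μ Y' →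
    μ = .succ ω ∨ ∃ X', Step X μ X' ∧ Flag ω X' Y' := by
  induction h with
  | base R =>
    intro μ Y' hs
    cases hs with
    | parL hs =>
      rw [act_weaken_succ]
      exact .inr ⟨_, hs, .base _⟩
    | parR hs =>
      cases hs
      exact .inl rfl
    | comHL _ hs => cases hs
    | comHR _ hs => cases hs
    | comFL _ hs => cases hs
    | comFR _ hs => cases hs
  | par A h ih =>
    intro μ X' hs
    cases hs with
    | parL hs => exact .inr ⟨_, .parL hs, .par _ (h.act_weaken _)⟩
    | parR hs => exact (ih hs).imp id fun ⟨Y', h1, h2⟩ => ⟨_, .parR h1, .par _ h2⟩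
    | comHL hA hs =>
      obtain ⟨Y', h1, h2⟩ := (ih hs).resolve_left (by simp)
      exact .inr ⟨_, .comHL hA h1, .res (.par _ h2)⟩
    | comHR hA hs =>
      obtain ⟨Y', h1, h2⟩ := (ih hs).resolve_left (by simp)
      exact .inr ⟨_, .comHR hA h1, .res (.par _ h2)⟩
    | comFL hA hs =>
      obtain ⟨Y', h1, h2⟩ := (ih hs).resolve_left (by simp)
      exact .inr ⟨_, .comFL hA h1, .par _ h2⟩
    | comFR hA hs =>
      obtain ⟨Y', h1, h2⟩ := (ih hs).resolve_left (by simp)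
      exact .inr ⟨_, .comFR hA h1, .par _ h2⟩
  | res _ ih =>
    intro μ X' hs
    cases hs with
    | resH hs =>
      refine (ih hs).imp (fun h => ?_) fun ⟨Y', h1, h2⟩ => ⟨_, .resH h1, h2.act_res _⟩
      cases μ <;> cases h
      rfl

theorem exists_barb (h : Flag ω X Y) : ∃ Y', Step Y (.succ ω) Y' := by
  induction h with
  | base R => exact ⟨_, .parR (.succ ω nil)⟩
  | par A _ ih =>
    obtain ⟨Y', h⟩ := ih
    exact ⟨_, .parR h⟩
  | res _ ih =>
    obtain ⟨Y', h⟩ := ih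
    exact ⟨_, .resH (μ := .succ ω) h⟩

theorem weakBarb (h : Flag ω X Y) : WeakBarb Y ω := ⟨Y, .refl, h.exists_barb⟩

theorem succIn (h : Flag ω X Y) {S : Set ℕ} (hω : ω ∈ S) (hX : X.SuccIn S) : Y.SuccIn S := by
  induction h with
  | base R => exact ⟨hX, hω, trivial⟩
  | par A _ ih => exact ⟨hX.1, ih hX.2⟩
  | res _ ih => exact ih hX

theorem reds (h : Flag ω X Y) {X' : Proc L 0} (hr : Reds X X') : ∃ Y', Reds Y Y' ∧ Flag ω X' Y' := by
  induction hr with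
  | refl => exact ⟨Y, .refl, h⟩
  | tail _ hr ih =>
    obtain ⟨Y', h1, h2⟩ := ih
    obtain ⟨Y'', h3, h4⟩ := h2.step hr
    exact ⟨Y'', h1.tail h3, h4⟩

theorem reds_inv (h : Flag ω X Y) {Y' : Proc L 0} (hr : Reds Y Y') :
    ∃ X', Reds X X' ∧ Flag ω X' Y' := by
  induction hr with
  | refl => exact ⟨X, .refl, h⟩
  | tail _ hr ih =>
    obtain ⟨X', h1, h2⟩ := ih
    obtain ⟨X'', h3, h4⟩ := (h2.step_inv hr).resolve_left (by simp)
    exact ⟨X'', h1.tail h3, h4⟩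

theorem weakBarb_iff (h : Flag ω X Y) {ω' : ℕ} (hω : ω' ≠ ω) : WeakBarb X ω' ↔ WeakBarb Y ω' := by
  constructor
  · rintro ⟨X', hr, X'', hs⟩
    obtain ⟨Y', h1, h2⟩ := h.reds hr
    obtain ⟨Y'', h3, -⟩ := h2.step hs
    exact ⟨Y', h1, Y'', h3⟩
  · rintro ⟨Y', hr, Y'', hs⟩
    obtain ⟨X', h1, h2⟩ := h.reds_inv hr
    obtain ⟨X'', h3, -⟩ := (h2.step_inv hs).resolve_left (by simpa using hω)
    exact ⟨X', h1, X'', h3⟩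

end Flag

theorem Interact.flag {A R Z : Proc L 0} (h : Interact A R Z) (ω : ℕ) :
    ∃ Z', Interact A (flagged ω R) Z' ∧ Flag ω Z Z' := by
  cases h with
  | tau h =>
    obtain ⟨R', h1, h2⟩ := (Flag.base R).step h
    exact ⟨_, .tau h1, .par A h2⟩
  | com hμ hA h =>
    obtain ⟨R', h1, h2⟩ := (Flag.base R).step h
    exact ⟨_, .com hμ hA h1, (h2.par _).act_scope _⟩

theorem Interact.of_flagged {ω : ℕ} {A R Z : Proc L 0} (h : Interact A (flagged ω R) Z) :
    ∃ Z₀, Interact A R Z₀ ∧ Flag ω Z₀ Z := by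
  cases h with
  | tau h =>
    obtain ⟨R', h1, h2⟩ := ((Flag.base R).step_inv h).resolve_left (by simp)
    exact ⟨_, .tau h1, .par A h2⟩
  | @com P' R' μ hμ hA h =>
    obtain ⟨R', h1, h2⟩ := ((Flag.base (ω := ω) R).step_inv h).resolve_left
      (by cases μ <;> simp_all [Act.Visible, Act.dual])
    exact ⟨_, .com hμ hA h1, (h2.par _).act_scope _⟩

theorem Interact.of_step_imp {A C Z : Proc L 0} {p : Proc L 0 → Prop} (h : Interact A C Z)
    (hC : ∀ μ X, Step C μ X → ∃ C', p C' ∧ Step C' μ X) : ∃ C', p C' ∧ Interact A C' Z := by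
  cases h with
  | tau h =>
    obtain ⟨C', h1, h2⟩ := hC _ _ h
    exact ⟨C', h1, .tau h2⟩
  | com hμ hA h =>
    obtain ⟨C', h1, h2⟩ := hC _ _ h
    exact ⟨C', h1, .com hμ hA h2⟩

theorem Interact.succIn {A C Z : Proc L 0} (h : Interact A C Z) {S : Set ℕ} (hA : A.SuccIn S)
    (hC : C.SuccIn S) : Z.SuccIn S := SuccIn.step h.red ⟨hA, hC⟩

/-! ### Menus: observers with a visible choice -/

/-- The process `C` offers the choice between `R₁` and `R₂`; which of them has been chosen can be
seen from the success names `ω₁`, `ω₂`, which are fresh elements of `O`. -/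
structure Menu (O : Set ℕ) (C R₁ R₂ : Proc L 0) (ω₁ ω₂ : ℕ) : Prop where
  step_iff : ∀ μ X, Step C μ X ↔ Step (flagged ω₁ R₁) μ X ∨ Step (flagged ω₂ R₂) μ X
  mem₁ : ω₁ ∈ O
  mem₂ : ω₂ ∈ O
  ne : ω₁ ≠ ω₂
  fresh₁ : R₁.SuccIn {ω₁, ω₂}ᶜ
  fresh₂ : R₂.SuccIn {ω₁, ω₂}ᶜ

namespace Menu

variable {O : Set ℕ} {C R₁ R₂ : Proc L 0} {ω₁ ω₂ : ℕ}

theorem swap (h : Menu O C R₁ R₂ ω₁ ω₂) : Menu O C R₂ R₁ ω₂ ω₁ where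
  step_iff μ X := (h.step_iff μ X).trans or_comm
  mem₁ := h.mem₂
  mem₂ := h.mem₁
  ne := h.ne.symm
  fresh₁ := by rw [Set.pair_comm]; exact h.fresh₂
  fresh₂ := by rw [Set.pair_comm]; exact h.fresh₁

theorem weakBarb (h : Menu O C R₁ R₂ ω₁ ω₂) (A : Proc L 0) : WeakBarb (par A C) ω₁ :=
  ⟨_, .refl, _, .parR ((h.step_iff _ _).2 (.inl (.parR (.succ ω₁ nil))))⟩

theorem subset (h : Menu O C R₁ R₂ ω₁ ω₂) : Oᶜ ⊆ {ω₁, ω₂}ᶜ := by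
  rw [Set.compl_subset_compl]
  rintro ω (rfl | rfl)
  · exact h.mem₁
  · exact h.mem₂

theorem interact (h : Menu O C R₁ R₂ ω₁ ω₂) {A Z : Proc L 0} (hi : Interact A R₁ Z) :
    ∃ Z', Interact A C Z' ∧ Flag ω₁ Z Z' := by
  obtain ⟨Z', hi, hf⟩ := hi.flag ω₁
  obtain ⟨_, rfl, hi⟩ := hi.of_step_imp (p := (· = C))
    fun μ X hs => ⟨C, rfl, (h.step_iff μ X).2 (.inl hs)⟩
  exact ⟨Z', hi, hf⟩

theorem interact_cases (h : Menu O C R₁ R₂ ω₁ ω₂) {A Z : Proc L 0} (hi : Interact A C Z) :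
    (∃ Z₀, Interact A R₁ Z₀ ∧ Flag ω₁ Z₀ Z) ∨ (∃ Z₀, Interact A R₂ Z₀ ∧ Flag ω₂ Z₀ Z) := by
  obtain ⟨_, rfl | rfl, hi⟩ := hi.of_step_imp
    (p := fun C' => C' = flagged ω₁ R₁ ∨ C' = flagged ω₂ R₂) fun μ X hs =>
      ((h.step_iff μ X).1 hs).elim (fun hs => ⟨_, .inl rfl, hs⟩) fun hs => ⟨_, .inr rfl, hs⟩
  · exact .inl hi.of_flagged
  · exact .inr hi.of_flagged

/-- Once the first item has been chosen, the name `ω₂` occurs nowhere any more. -/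
theorem not_weakBarb (h : Menu O C R₁ R₂ ω₁ ω₂) {A Z Z₀ Y : Proc L 0} (hA : A.SuccIn Oᶜ)
    (hi : Interact A R₁ Z₀) (hf : Flag ω₁ Z₀ Z) (hr : Reds Z Y) : ¬ WeakBarb Y ω₂ := by
  intro hb
  have hZ₀ : Z₀.SuccIn {ω₁, ω₂}ᶜ := hi.succIn (hA.mono h.subset) h.fresh₁
  have hZ : Z.SuccIn {ω₂}ᶜ := hf.succIn h.ne (hZ₀.mono (by simp))
  exact hZ.mem_of_weakBarb (hb.of_reds hr) rfl

theorem uncommitted (h : Menu O C R₁ R₂ ω₁ ω₂) {B Y : Proc L 0} (hB : B.SuccIn Oᶜ)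
    (hr : Reds (par B C) Y) (h1 : WeakBarb Y ω₁) (h2 : WeakBarb Y ω₂) :
    ∃ B', Reds B B' ∧ Y = par B' C := by
  rcases hr.par_cases with hY | ⟨B', Z, hr, hi, hZ⟩
  · exact hY
  · rcases h.interact_cases hi with ⟨Z₀, hi, hf⟩ | ⟨Z₀, hi, hf⟩
    · exact (h.not_weakBarb (hB.reds hr) hi hf hZ h2).elim
    · exact (h.swap.not_weakBarb (hB.reds hr) hi hf hZ h1).elim

theorem committed (h : Menu O C R₁ R₂ ω₁ ω₂) {B Y : Proc L 0} (hB : B.SuccIn Oᶜ)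
    (hr : Reds (par B C) Y) (h1 : WeakBarb Y ω₁) (h2 : ¬ WeakBarb Y ω₂) :
    ∃ Y₀, Reds (par B R₁) Y₀ ∧ Flag ω₁ Y₀ Y := by
  rcases hr.par_cases with ⟨B', -, rfl⟩ | ⟨B', Z, hr, hi, hZ⟩
  · exact (h2 (h.swap.weakBarb B')).elim
  · rcases h.interact_cases hi with ⟨Z₀, hi, hf⟩ | ⟨Z₀, hi, hf⟩
    · obtain ⟨Y₀, hr', hf⟩ := hf.reds_inv hZ
      exact ⟨Y₀, ((hr.par_left R₁).tail hi.red).trans hr', hf⟩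
    · exact (h.swap.not_weakBarb (hB.reds hr) hi hf hZ h1).elim

/-- The pairs that show that a menu discriminates as much as its items. -/
inductive Rel (O : Set ℕ) (C R₁ : Proc L 0) (ω₁ : ℕ) : Proc L 0 → Proc L 0 → Prop
  | menu {A B : Proc L 0} : A.SuccIn Oᶜ → B.SuccIn Oᶜ → BarbedBisimilarOn O (par A C) (par B C) →
      Rel O C R₁ ω₁ (par A R₁) (par B R₁)
  | flag {X₀ Y₀ X Y : Proc L 0} : X₀.SuccIn {ω₁}ᶜ → Y₀.SuccIn {ω₁}ᶜ → Flag ω₁ X₀ X →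
      Flag ω₁ Y₀ Y → BarbedBisimilarOn O X Y → Rel O C R₁ ω₁ X₀ Y₀

/-- A step of `A` alone leaves both barbs, so the answer of `B | C` cannot have touched the menu. A
step involving `R₁` is replayed through the menu and loses `ω₂`, so the answer must have chosen `R₁`
too; from then on the flagged processes are compared. Before the choice, barbs in `O` come from
`R₁`, which both sides share. -/
theorem left (h : Menu O C R₁ R₂ ω₁ ω₂) {A B : Proc L 0} (hA : A.SuccIn Oᶜ) (hB : B.SuccIn Oᶜ)
    (hAB : BarbedBisimilarOn O (par A C) (par B C)) :
    BarbedBisimilarOn O (par A R₁) (par B R₁) := by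
  have fresh : ∀ {A : Proc L 0}, A.SuccIn Oᶜ → (par A R₁).SuccIn {ω₁}ᶜ := fun hA =>
    ⟨(hA.mono h.subset).mono (by simp), h.fresh₁.mono (by simp)⟩
  refine ⟨Rel O C R₁ ω₁, .of_step ?_ ?_ ?_, .menu hA hB hAB⟩
  · rintro _ _ (⟨hA, hB, h⟩ | ⟨hX, hY, fX, fY, h⟩)
    · exact .menu hB hA h.symm
    · exact .flag hY hX fY fX h.symm
  · rintro _ _ (⟨hA, hB, hb⟩ | ⟨hX, hY, fX, fY, hb⟩) X' hr
    · rename_i A B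
      rcases hr.par_cases with ⟨A', hA', rfl⟩ | hi
      · obtain ⟨Y, h1, h2⟩ := hb.red (hA'.par_left C)
        obtain ⟨B', hB', rfl⟩ := h.uncommitted hB h1 ((h2.barb_iff h.mem₁).1 (h.weakBarb _))
          ((h2.barb_iff h.mem₂).1 (h.swap.weakBarb _))
        exact ⟨_, hB'.par_left R₁, .menu (hA.step hA') (hB.reds hB') h2⟩
      · obtain ⟨X, hiC, hf⟩ := h.interact hi
        obtain ⟨Y, h1, h2⟩ := hb.red hiC.red
        obtain ⟨Y₀, hr, hf'⟩ := h.committed hB h1 ((h2.barb_iff h.mem₁).1 hf.weakBarb)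
          fun hY => h.not_weakBarb hA hi hf .refl ((h2.barb_iff h.mem₂).2 hY)
        exact ⟨Y₀, hr, .flag ((fresh hA).step hi.red) ((fresh hB).reds hr) hf hf' h2⟩
    · obtain ⟨X', hr', hf⟩ := fX.step hr
      obtain ⟨Y', h1, h2⟩ := hb.red hr'
      obtain ⟨Y₀', h3, h4⟩ := fY.reds_inv h1
      exact ⟨Y₀', h3, .flag (hX.step hr) (hY.reds h3) hf h4 h2⟩
  · rintro _ _ (⟨hA, hB, hb⟩ | ⟨hX, hY, fX, fY, hb⟩) ω hω X' hs
    · cases hs with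
      | parL hs => exact (SuccIn.mem_of_step hs rfl hA hω).elim
      | parR hs => exact ⟨_, .refl, _, .parR hs⟩
    · have hne : ω ≠ ω₁ := SuccIn.mem_of_step hs rfl hX
      refine (fY.weakBarb_iff hne).2 ((hb.barb_iff hω).1 ((fX.weakBarb_iff hne).1 ?_))
      exact ⟨_, .refl, _, hs⟩

theorem sum (h₁ : ω₁ ∈ O) (h₂ : ω₂ ∈ O) (ne : ω₁ ≠ ω₂) (f₁ : R₁.SuccIn {ω₁, ω₂}ᶜ)
    (f₂ : R₂.SuccIn {ω₁, ω₂}ᶜ) :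
    Menu O (Proc.sum (flagged ω₁ R₁) (flagged ω₂ R₂)) R₁ R₂ ω₁ ω₂ where
  step_iff μ X := by
    constructor
    · intro hs
      cases hs with
      | sumL hs => exact .inl hs
      | sumR hs => exact .inr hs
    · rintro (hs | hs)
      · exact .sumL hs
      · exact .sumR hs
  mem₁ := h₁
  mem₂ := h₂
  ne := ne
  fresh₁ := f₁
  fresh₂ := f₂

/-- After a successful check of a received value, the observer is a menu below a conditional. Menus
are characterised by their transitions so that this is again one. -/
theorem cond (h : Menu O C R₁ R₂ ω₁ ω₂) (e : Expr L 0) (E : Proc L 0) :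
    Menu O (Proc.cond e e C E) R₁ R₂ ω₁ ω₂ where
  step_iff μ X := by
    rw [← h.step_iff]
    constructor
    · intro hs
      cases hs with
      | condT _ hs => exact hs
      | condF hne _ => exact absurd rfl hne
    · exact .condT rfl
  mem₁ := h.mem₁
  mem₂ := h.mem₂
  ne := h.ne
  fresh₁ := h.fresh₁
  fresh₂ := h.fresh₂

end Menu

end VPi

namespace VPi

universe u

variable {L : ExprLang.{u}}

open Proc VisFun

/-! ### Tests for a single action -/

theorem typed_flagged {Γ : VisFun} {R : Proc L 0} (h : Typed Γ R) (ω : ℕ) :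
    Typed Γ (flagged ω R) := h.par_left .succ

theorem VStep.of_step {Γ Γ' : VisFun} {P P' Q Q' : Proc L 0} {μ : Act L}
    (h : VStep Γ P μ Γ' P') (hs : Step Q μ Q') : VStep Γ Q μ Γ' Q' := by
  cases h with
  | outH _ h1 h2 => exact .outH hs h1 h2
  | inH _ h1 h2 => exact .inH hs h1 h2
  | outF _ h1 => exact .outF hs h1
  | inF _ h1 => exact .inF hs h1
  | tau _ h1 => exact .tau hs h1

theorem CoTyped.weakVStep_of_reds {Γ Γ' : VisFun} {P P' Q Q₁ Q₂ Q₃ : Proc L 0} {μ : Act L}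
    (hQ : CoTyped Γ Q) (hμ : μ ≠ .tau) (h : VStep Γ P μ Γ' P') (h1 : Reds Q Q₁)
    (h2 : Step Q₁ μ Q₂) (h3 : Reds Q₂ Q₃) : WeakVStep Γ Q μ Γ' Q₃ := by
  have h1 := hQ.vReds_of_reds h1
  have h2 := h.of_step h2
  exact .act hμ h1 h2 (((hQ.vReds h1).vStep h2).vReds_of_reds h3)

/-- If `X` can only signal `ω`, then `A | X` has no other success names than `A`. -/
theorem not_weakBarb_par {A X : Proc L 0} {S : Set ℕ} {ω ω' : ℕ} (hA : A.SuccIn S)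
    (hX : ∀ ν X', Step X ν X' → ν = .succ ω) (hS : ω' ∉ S) (hne : ω' ≠ ω) :
    ¬ WeakBarb (par A X) ω' := by
  rintro ⟨Y, hr, Y', hs⟩
  rcases hr.par_cases with ⟨A', hA', rfl⟩ | ⟨A', Z, -, hi, -⟩
  · cases hs with
    | parL hs => exact hS (SuccIn.mem_of_step hs rfl (hA.reds hA'))
    | parR hs => exact hne (by simpa using hX _ _ hs)
  · cases hi with
    | tau h => simpa using hX _ _ h
    | @com P' R' μ hμ _ h =>
      have := hX _ _ h
      cases μ <;> simp_all [Act.Visible, Act.dual]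

/-- The test `T` waits for the action `μ` and then becomes the menu `C`. -/
structure IsTest (O : Set ℕ) (T C : Proc L 0) (μ : Act L) (ω ω₂ : ℕ) : Prop where
  mem : ω ∈ O
  fresh : C.SuccIn {ω}ᶜ
  barb : Step T (.succ ω) nil
  step : Step T μ.dual C
  cases : ∀ ν X, Step T ν X → ν = .succ ω ∨ (ν = μ.dual ∧ X = C) ∨
    ∀ ν' X', Step X ν' X' → ν' = .succ ω₂

theorem Act.dual_dual (μ : Act L) : μ.dual.dual = μ := by cases μ <;> rfl

/-- The three success names control the answer of `Q | T`: absence of `ω` shows that the test has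
been used, presence of `ω₁` that the action was the right one, and presence of both `ω₁` and `ω₂`
that the menu is still untouched. -/
theorem IsTest.exists_weakVStep {O : Set ℕ} {T C R₁ R₂ : Proc L 0} {μ : Act L} {ω ω₁ ω₂ : ℕ}
    (hT : IsTest O T C μ ω ω₂) (hC : Menu O C R₁ R₂ ω₁ ω₂) (hμ : μ.Visible) {Γ Γ' : VisFun}
    {P P' Q : Proc L 0} (hs : VStep Γ P μ Γ' P') (hQ : CoTyped Γ Q) (sP : P.SuccIn Oᶜ)
    (sQ : Q.SuccIn Oᶜ) (h : BarbedBisimilarOn O (par P T) (par Q T)) :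
    ∃ Q', WeakVStep Γ Q μ Γ' Q' ∧ BarbedBisimilarOn O (par P' C) (par Q' C) := by
  obtain ⟨Y, hr, hY⟩ := h.red (Interact.com hμ hs.step hT.step).red
  have b₁ : WeakBarb Y ω₁ := (hY.barb_iff hC.mem₁).1 (weakBarb_scope.2 (hC.weakBarb _))
  have b₂ : WeakBarb Y ω₂ := (hY.barb_iff hC.mem₂).1 (weakBarb_scope.2 (hC.swap.weakBarb _))
  rcases hr.par_cases with ⟨Q₁, -, rfl⟩ | ⟨Q₁, Z, hQ₁, hi, hZ⟩
  · have hb : WeakBarb (par P' C) ω :=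
      weakBarb_scope.1 ((hY.barb_iff hT.mem).2 ⟨_, .refl, _, .parR hT.barb⟩)
    have hP' : P'.SuccIn {ω}ᶜ :=
      (sP.step hs.step).mono (Set.compl_subset_compl.2 (by simpa using hT.mem))
    exact (SuccIn.mem_of_weakBarb (P := par P' C) ⟨hP', hT.fresh⟩ hb rfl).elim
  · have hne := hC.ne
    have sQ₁ := sQ.reds hQ₁
    cases hi with
    | tau hX =>
      rcases hT.cases _ _ hX with h0 | ⟨h0, -⟩ | h0
      · cases h0
      · cases μ <;> first | exact hμ.elim | cases h0
      · exact (not_weakBarb_par sQ₁ h0 (by simpa using hC.mem₁) hne (b₁.of_reds hZ)).elim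
    | @com Q₂ X ν hν hQ₂ hX =>
      rcases hT.cases _ _ hX with h0 | ⟨h0, rfl⟩ | h0
      · cases ν <;> first | exact hν.elim | cases h0
      · have : ν = μ := by rw [← ν.dual_dual, h0, μ.dual_dual]
        subst this
        obtain ⟨Y₀, hY₀, rfl⟩ := hZ.scope_cases
        obtain ⟨Q₃, hQ₃, rfl⟩ := hC.uncommitted (sQ₁.step hQ₂) hY₀ (weakBarb_scope.1 b₁)
          (weakBarb_scope.1 b₂)
        refine ⟨Q₃, hQ.weakVStep_of_reds ?_ hs hQ₁ hQ₂ hQ₃, hY.of_scope⟩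
        rintro rfl
        exact hν
      · exact (not_weakBarb_par (sQ₁.step hQ₂) h0 (by simpa using hC.mem₁) hne
          (weakBarb_scope.1 (b₁.of_reds hZ))).elim

/-- The test for a received value: `if x = v then C else ω. 0`. -/
def guard (v : L.Val) (C : Proc L 0) (ω : ℕ) : Proc L 1 :=
  cond (.var 0) (.val v) (C.subst fun i => i.elim0) (succ ω nil)

theorem guard_inst (v w : L.Val) (C : Proc L 0) (ω : ℕ) :
    (guard v C ω).inst w = cond (.val w) (.val v) C (succ ω nil) := by
  simp [guard, Proc.inst, Proc.close, Proc.subst, Expr.subst, Proc.subst_subst,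
    Proc.subst_eq_self]

theorem typed_guard {Γ : VisFun} {C : Proc L 0} (h : Typed Γ C) (v : L.Val) (ω : ℕ) :
    Typed Γ (guard v C ω) := .cond (h.subst _) .succ

theorem step_guard_inst_of_ne {v w : L.Val} (hne : w ≠ v) {C X : Proc L 0} {ω : ℕ} {μ : Act L}
    (h : Step ((guard v C ω).inst w) μ X) : μ = .succ ω := by
  rw [guard_inst] at h
  cases h with
  | condT h _ => exact absurd h hne
  | condF _ h => cases h; rfl

theorem isTest_sum {O : Set ℕ} {T C : Proc L 0} {μ : Act L} {ω ω₂ : ℕ} (mem : ω ∈ O)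
    (fresh : C.SuccIn {ω}ᶜ) (step : Step T μ.dual C)
    (cases : ∀ ν X, Step T ν X → (ν = μ.dual ∧ X = C) ∨ ∀ ν' X', Step X ν' X' → ν' = .succ ω₂) :
    IsTest O (sum (succ ω nil) T) C μ ω ω₂ where
  mem := mem
  fresh := fresh
  barb := .sumL (.succ ω nil)
  step := .sumR step
  cases ν X h := by
    cases h with
    | sumL h => cases h; exact .inl rfl
    | sumR h => exact .inr (cases ν X h)

theorem exists_test {O : Set ℕ} {C R₁ R₂ : Proc L 0} {ω ω₁ ω₂ : ℕ}
    (hC : Menu O C R₁ R₂ ω₁ ω₂) (mem : ω ∈ O) (hω : ω₂ ≠ ω) (fresh : C.SuccIn {ω}ᶜ)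
    {Γ Γ' : VisFun} {P P' : Proc L 0} {μ : Act L} (hs : VStep Γ P μ Γ' P') (hμ : μ ≠ .tau)
    (tC : Typed Γ' C) :
    μ.Visible ∧ ∃ T C', Typed Γ T ∧ Menu O C' R₁ R₂ ω₁ ω₂ ∧ IsTest O T C' μ ω ω₂ := by
  cases hs with
  | tau => exact absurd rfl hμ
  | @inH S _ _ a v h hS ha =>
    refine ⟨trivial, _, C, .sum .succ (.outH (e := .val v) hS ha tC), hC,
      isTest_sum mem fresh (.outH a (.val v) C) fun ν X h => ?_⟩
    cases h
    exact .inl ⟨rfl, rfl⟩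
  | @inF _ _ k v h hΓ =>
    refine ⟨trivial, _, C, .sum .succ (.outF (h := k) (e := .val v) tC hΓ), hC,
      isTest_sum mem fresh (.outF k (.val v) C) fun ν X h => ?_⟩
    cases h
    exact .inl ⟨rfl, rfl⟩
  | @outH _ _ a v h ha hΓ =>
    -- An observer that inputs cannot select the value in advance and checks it afterwards. The
    -- failing branch has to be typed under the same visibility as the menu, which `ω₂.0` always is;
    -- it lacks the barb `ω₁`.
    have hC' := hC.cond (.val v) (succ ω₂ nil)
    rw [← guard_inst] at hC'
    refine ⟨trivial, _, _, .sum .succ (.inH hΓ ha (typed_guard tC v ω₂)), hC',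
      isTest_sum mem ?_ (.inH a v _) fun ν X h => ?_⟩
    · rw [guard_inst]
      exact ⟨fresh, hω, trivial⟩
    · cases h with
      | inH _ w _ =>
        by_cases hw : w = v
        · subst hw
          exact .inl ⟨rfl, rfl⟩
        · exact .inr fun ν' X' h => step_guard_inst_of_ne hw h
  | @outF _ _ k v h hΓ =>
    have hC' := hC.cond (.val v) (succ ω₂ nil)
    rw [← guard_inst] at hC'
    refine ⟨trivial, _, _, .sum .succ (.inF (h := k) (typed_guard tC v ω₂) hΓ), hC',
      isTest_sum mem ?_ (.inF k v _) fun ν X h => ?_⟩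
    · rw [guard_inst]
      exact ⟨fresh, hω, trivial⟩
    · cases h with
      | inF _ w _ =>
        by_cases hw : w = v
        · subst hw
          exact .inl ⟨rfl, rfl⟩
        · exact .inr fun ν' X' h => step_guard_inst_of_ne hw h

/-! ### Completeness -/

/-- Any two observers can be offered in a menu, and there is one more fresh success name. -/
theorem exists_menu (M : ℕ) {Γ : VisFun} {R₁ R₂ : Proc L 0} (t₁ : Typed Γ R₁) (t₂ : Typed Γ R₂) :
    ∃ C ω₁ ω₂ ω, Typed Γ C ∧ Menu (Set.Ici M) C R₁ R₂ ω₁ ω₂ ∧ ω ∈ Set.Ici M ∧ ω₂ ≠ ω ∧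
      C.SuccIn {ω}ᶜ := by
  -- The three names from `max M N` on avoid the observers because of `N`, and belong to the
  -- compared names because of `M`.
  obtain ⟨N, hN⟩ := SuccIn.exists_lt (par R₁ R₂)
  have mem : ∀ i, max M N + i ∈ Set.Ici M := fun i => by
    simp only [Set.mem_Ici]; omega
  have sub : Set.Iio N ⊆ {max M N, max M N + 1, max M N + 2}ᶜ := by
    intro k hk
    simp only [Set.mem_Iio, Set.mem_compl_iff, Set.mem_insert_iff, Set.mem_singleton_iff] at hk ⊢
    omega
  have sub₁ : ({max M N, max M N + 1, max M N + 2}ᶜ : Set ℕ) ⊆ {max M N, max M N + 1}ᶜ := by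
    intro k hk
    simp only [Set.mem_compl_iff, Set.mem_insert_iff, Set.mem_singleton_iff] at hk ⊢
    omega
  have sub₂ : ({max M N, max M N + 1, max M N + 2}ᶜ : Set ℕ) ⊆ {max M N + 2}ᶜ := by
    intro k hk
    simp only [Set.mem_compl_iff, Set.mem_insert_iff, Set.mem_singleton_iff] at hk ⊢
    omega
  have s₁ := hN.1.mono sub
  have s₂ := hN.2.mono sub
  refine ⟨_, max M N, max M N + 1, max M N + 2, .sum (typed_flagged t₁ _) (typed_flagged t₂ _),
    .sum (mem 0) (mem 1) (by omega) (s₁.mono sub₁) (s₂.mono sub₁), mem 2, by omega,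
    ⟨s₁.mono sub₂, ?_, trivial⟩, ⟨s₂.mono sub₂, ?_, trivial⟩⟩ <;>
  simp

/-- Finitely many observers can be combined into a single one. -/
theorem exists_observer (M : ℕ) {Γ : VisFun} {P : Proc L 0} (sP : P.SuccIn (Set.Ici M)ᶜ)
    {D : Set (Proc L 0)} (hD : D.Finite) :
    (∀ Q ∈ D, Q.SuccIn (Set.Ici M)ᶜ) →
    (∀ Q ∈ D, ∃ R, Typed Γ R ∧ ¬ BarbedBisimilarOn (Set.Ici M) (par P R) (par Q R)) →
    ∃ R, Typed Γ R ∧ ∀ Q ∈ D, ¬ BarbedBisimilarOn (Set.Ici M) (par P R) (par Q R) := by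
  induction D, hD using Set.Finite.induction_on with
  -- Nothing is to be separated, but an observer typed by an arbitrary `Γ` is needed; the choice of
  -- the name `0` is irrelevant.
  | empty => exact fun _ _ => ⟨succ 0 nil, .succ, by simp⟩
  | @insert Q D _ _ ih =>
    intro sD h
    obtain ⟨R₁, t₁, h₁⟩ := h Q (Set.mem_insert _ _)
    obtain ⟨R₂, t₂, h₂⟩ := ih (fun Q' hQ' => sD Q' (Set.mem_insert_of_mem _ hQ'))
      fun Q' hQ' => h Q' (Set.mem_insert_of_mem _ hQ')
    obtain ⟨C, ω₁, ω₂, -, tC, hC, -⟩ := exists_menu M t₁ t₂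
    refine ⟨C, tC, fun Q' hQ' hb => ?_⟩
    have sQ' := sD Q' hQ'
    rcases hQ' with rfl | hQ'
    · exact h₁ (hC.left sP sQ' hb)
    · exact h₂ Q' hQ' (hC.swap.left sP sQ' hb)

/-- Barbed equivalence at `Γ` with respect to the success names from `M` on, on image-finite closed
processes without such success names. -/
structure Indistinguishable (M : ℕ) (Γ : VisFun) (P Q : Proc L 0) : Prop where
  finite_left : ∀ Γ' P', Derivative Γ P Γ' P' → ∀ μ, {P'' | ∃ Γ'', WeakVStep Γ' P' μ Γ'' P''}.Finite
  finite_right : ∀ Γ' Q', Derivative Γ Q Γ' Q' →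
    ∀ μ, {Q'' | ∃ Γ'', WeakVStep Γ' Q' μ Γ'' Q''}.Finite
  typed_left : CoTyped Γ P
  typed_right : CoTyped Γ Q
  succ_left : P.SuccIn (Set.Ici M)ᶜ
  succ_right : Q.SuccIn (Set.Ici M)ᶜ
  bisim : ∀ R, Typed Γ R → BarbedBisimilarOn (Set.Ici M) (par P R) (par Q R)

theorem Indistinguishable.symm {M : ℕ} {Γ : VisFun} {P Q : Proc L 0}
    (h : Indistinguishable M Γ P Q) : Indistinguishable M Γ Q P :=
  ⟨h.2, h.1, h.4, h.3, h.6, h.5, fun R hR => (h.bisim R hR).symm⟩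

theorem Derivative.trans {Γ Γ' Γ'' : VisFun} {P P' P'' : Proc L 0} (h : Derivative Γ P Γ' P')
    (h' : Derivative Γ' P' Γ'' P'') : Derivative Γ P Γ'' P'' := by
  induction h' with
  | refl => exact h
  | tail _ hs ih => exact ih.tail hs

theorem VReds.derivative {Γ : VisFun} {P P' : Proc L 0} (h : VReds Γ P P') :
    Derivative Γ P Γ P' := by
  induction h with
  | refl => exact .refl
  | tail _ hs ih => exact ih.tail hs

theorem WeakVStep.derivative {Γ Γ' : VisFun} {P P' : Proc L 0} {μ : Act L}
    (h : WeakVStep Γ P μ Γ' P') : Derivative Γ P Γ' P' := by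
  cases h with
  | tau h => exact h.derivative
  | act _ h1 h2 h3 => exact (h1.derivative.tail h2).trans h3.derivative

theorem Indistinguishable.vStep {M : ℕ} {Γ Γ' : VisFun} {P P' Q : Proc L 0} {μ : Act L}
    (h : Indistinguishable M Γ P Q) (hs : VStep Γ P μ Γ' P') :
    ∃ Q', WeakVStep Γ Q μ Γ' Q' ∧ Indistinguishable M Γ' P' Q' := by
  by_contra! hcon
  let D : Set (Proc L 0) := {Q' | WeakVStep Γ Q μ Γ' Q'}
  have hD : D.Finite := (h.finite_right Γ Q .refl μ).subset fun Q' hQ' => ⟨Γ', hQ'⟩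
  have sP' := h.succ_left.step hs.step
  have hR : ∀ Q' ∈ D, ∃ R, Typed Γ' R ∧
      ¬ BarbedBisimilarOn (Set.Ici M) (par P' R) (par Q' R) := by
    intro Q' hQ'
    by_contra! hR
    exact hcon Q' hQ'
      { finite_left := fun Γ'' P'' hd => h.finite_left _ _ ((Derivative.refl.tail hs).trans hd)
        finite_right := fun Γ'' Q'' hd => h.finite_right _ _ ((WeakVStep.derivative hQ').trans hd)
        typed_left := h.typed_left.vStep hs
        typed_right := h.typed_right.weakVStep hQ'
        succ_left := sP'
        succ_right := hQ'.succIn h.succ_right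
        bisim := hR }
  obtain ⟨R, tR, hR⟩ := exists_observer M sP' hD (fun Q' hQ' => hQ'.succIn h.succ_right) hR
  -- The second item is a dummy: it serves to make `ω₂` reveal whether the separating observer `R`
  -- has already acted.
  obtain ⟨C, ω₁, ω₂, ω, tC, hC, mem, hω, fresh⟩ :=
    exists_menu M tR (.succ : Typed Γ' (succ 0 nil : Proc L 0))
  suffices ∃ C, Menu (Set.Ici M) C R (succ 0 nil) ω₁ ω₂ ∧
      ∃ Q', WeakVStep Γ Q μ Γ' Q' ∧ BarbedBisimilarOn (Set.Ici M) (par P' C) (par Q' C) by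
    obtain ⟨C, hC, Q', hQ', hb⟩ := this
    exact hR Q' hQ' (hC.left sP' (hQ'.succIn h.succ_right) hb)
  by_cases hμ : μ = .tau
  · subst hμ
    refine ⟨C, hC, ?_⟩
    cases hs with
    | tau hP hΓ =>
      -- For `τ` no test is required: both barbs of the menu remain, so the answer consists of
      -- reductions of `Q` alone.
      obtain ⟨Y, hr, hY⟩ := (h.bisim C tC).red (Red.par_left hP C)
      obtain ⟨Q', hQ', rfl⟩ := hC.uncommitted h.succ_right hr
        ((hY.barb_iff hC.mem₁).1 (hC.weakBarb _)) ((hY.barb_iff hC.mem₂).1 (hC.swap.weakBarb _))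
      exact ⟨Q', .tau (hQ'.vReds hΓ), hY⟩
  · obtain ⟨hv, T, C', tT, hC', hT⟩ := exists_test hC mem hω fresh hs hμ tC
    exact ⟨C', hC', hT.exists_weakVStep hC' hv hs h.typed_right h.succ_left h.succ_right
      (h.bisim T tT)⟩

theorem Indistinguishable.typedBisimilar {M : ℕ} {Γ : VisFun} {P Q : Proc L 0}
    (h : Indistinguishable M Γ P Q) : TypedBisimilar Γ P Q := by
  refine ⟨Indistinguishable M, ⟨fun Γ P Q h μ Γ' P' hs => h.vStep hs,
    fun Γ P Q h μ Γ' Q' hs => ?_⟩, h⟩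
  obtain ⟨P', h1, h2⟩ := h.symm.vStep hs
  exact ⟨P', h1, h2.symm⟩

end VPi

theorem mainTheorem3 {L : VPi.ExprLang} {n : ℕ} (Δ Γ : VPi.VisFun) (P Q : VPi.Proc L n) :
    (P.SuccessFree → Q.SuccessFree →
      VPi.BisimilarUnder Δ Γ P Q → VPi.BarbedEquiv Δ Γ P Q) ∧
    (VPi.ImageFinite Γ P → VPi.ImageFinite Γ Q →
      VPi.BarbedEquiv Δ Γ P Q → VPi.BisimilarUnder Δ Γ P Q) := by
  open VPi in
  refine ⟨fun sP sQ h => ⟨h.compatible, h.typed_left, h.typed_right, fun σ R hR => ?_⟩,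
    fun iP iQ h => ⟨h.compatible, h.typed_left, h.typed_right, fun σ => ?_⟩⟩
  · exact soundness (h.bisim σ) ⟨Δ, h.compatible, h.typed_left.subst _⟩
      ⟨Δ, h.compatible, h.typed_right.subst _⟩ ((Proc.SuccIn.of_successFree sP).subst _)
      ((Proc.SuccIn.of_successFree sQ).subst _) hR
  -- `M` is chosen before closing substitutions are applied, which introduce no success names.
  · obtain ⟨M, hM⟩ := Proc.SuccIn.exists_lt (Proc.par P Q)
    rw [← Set.compl_Ici] at hM
    exact Indistinguishable.typedBisimilar (M := M)
      { finite_left := iP σ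
        finite_right := iQ σ
        typed_left := ⟨Δ, h.compatible, h.typed_left.subst _⟩
        typed_right := ⟨Δ, h.compatible, h.typed_right.subst _⟩
        succ_left := hM.1.subst _
        succ_right := hM.2.subst _
        bisim := fun R hR => (h.equiv σ R hR).on _ }
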